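/- Let $d\ge 1$, let $p=(p_1,\dots,p_d)$ be a vector of positive integers with $P=p_1\cdots p_d\ge 2$, and let $V:\mathbb Z^d\to\mathbb R$ be $p$-periodic, i.e. $V(n+p_je_j)=V(n)$ for all $n\in\mathbb Z^d$ and all $j$, where $e_1,\dots,e_d$ are the standard unit vectors. Put $$\mathbb B_p=\Big\{\Big(\frac{k_1}{p_1},\dots,\frac{k_d}{p_d}\Big):\ 0\le k_j\le p_j-1\Big\}$$ with addition modulo $1$, and write $V(n)=\sum_{k\in\mathbb B_p}\widehat V(k)\,e^{2\pi i k\cdot n}$. For $x\in\mathbb R^d$ let $\widehat H_x$ be the self-adjoint operator on the $P$-dimensional space $\ell^2(\mathbb B_p)$ given by $$\widehat H_x\psi(k)=\sum_{j=1}^d 2\cos\big(2\pi(x_j+k_j)\big)\psi(k)+\sum_{\ell\in\mathbb B_p}\widehat V(\ell)\,\psi(k+\ell),$$ and let $E(x,1)\le E(x,2)\le\dots\le E(x,P)$ be its eigenvalues, listed with multiplicity. They are $1$-periodic in each coordinate of $x$, so $x$ may be taken in $\mathbb T^d$, $\mathbb T=\mathbb R/\mathbb Z$. For $\delta>0$ the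 spectrum of $\widehat H_x$ is called $\delta$-simple if $E(x,\ell+1)-E(x,\ell)\ge\delta$ for all $1\le\ell\le P-1$. There is a constant $C>1$, depending only on $d$ and $\|V\|_\infty=\sup_n|V(n)|$, such that for every $\eta\in(0,\tfrac12)$ there is a measurable set $\mathcal G\subseteq\mathbb T^d$ with the following properties: 1. $|\mathbb T^d\setminus\mathcal G|\le\eta$, where $|\cdot|$ denotes Lebesgue measure. 2. For $x\in\mathcal G$, the spectrum of $\widehat H_x$ is $\delta$-simple with $\delta=\eta^{C P^2\log P}$. 3. For $x\in\mathcal G$ and every $1\le\ell\le P$, the partial derivative $\partial_{x_d}E(x,\ell)$ exists and $|\partial_{x_d}E(x,\ell)|\ge\gamma$ with $\gamma=\eta^{C P^2\log P}$. -/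

import Mathlib

noncomputable section

namespace PeriodicSchrodinger

/-- `V : ℤ^d → ℝ` is `p`-periodic: it is invariant under translation by `p j` in the `j`-th
coordinate, for every `j`. -/
def IsPeriodic {d : ℕ} (p : Fin d → ℕ) (V : (Fin d → ℤ) → ℝ) : Prop :=
  ∀ (j : Fin d) (n : Fin d → ℤ), V (Function.update n j (n j + (p j : ℤ))) = V n

/-- The norm of `V` in `ℓ^∞(ℤ^d)` (periodic functions are bounded). -/
def supNorm {d : ℕ} (V : (Fin d → ℤ) → ℝ) : ℝ := ⨆ n, |V n|

/-- The group `𝔹_p` of the points `(k_1 / p_1, …, k_d / p_d)` of the torus, `0 ≤ k_j ≤ p_j - 1`,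
with addition modulo one. An element is given by its numerators `k_j`, modulo `p_j`. -/
abbrev Freq {d : ℕ} (p : Fin d → ℕ) : Type := ∀ j : Fin d, ZMod (p j)

/-- The `j`-th coordinate `k_j / p_j ∈ [0, 1)` of a point of `𝔹_p`. -/
def Freq.coord {d : ℕ} {p : Fin d → ℕ} (k : Freq p) (j : Fin d) : ℝ :=
  ((k j).val : ℝ) / (p j : ℝ)

variable {d : ℕ} (p : Fin d → ℕ) [∀ j, NeZero (p j)] (V : (Fin d → ℤ) → ℝ)

/-- The Fourier coefficient
`V̂(k) = (p_1 ⋯ p_d)⁻¹ ∑_{0 ≤ n_j < p_j} V(n) exp(-2 π i k · n)`, `k ∈ 𝔹_p`; these are the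
coefficients for which `V(n) = ∑_{k ∈ 𝔹_p} V̂(k) exp(2 π i k · n)` if `V` is `p`-periodic. -/
def potentialCoeff (k : Freq p) : ℂ :=
  (∏ j, (p j : ℂ))⁻¹ *
    ∑ n : (∀ j : Fin d, Fin (p j)), (V (fun j => ((n j : ℕ) : ℤ)) : ℂ) *
      Complex.exp (-(2 * Real.pi * Complex.I * ∑ j, (k.coord j : ℂ) * ((n j : ℕ) : ℂ)))

/-- The matrix of the operator `Ĥ_x` on `ℓ²(𝔹_p)`,
`(Ĥ_x ψ)(k) = ∑_j 2 cos(2 π (x_j + k_j)) ψ(k) + ∑_{ℓ ∈ 𝔹_p} V̂(ℓ) ψ(k + ℓ)`.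
In the second sum, `ψ(m)` has the coefficient `V̂(m - k)`. -/
def blochMatrix (x : Fin d → ℝ) : Matrix (Freq p) (Freq p) ℂ :=
  Matrix.diagonal (fun k => ((∑ j, 2 * Real.cos (2 * Real.pi * (x j + k.coord j)) : ℝ) : ℂ)) +
    Matrix.of (fun k m => potentialCoeff p V (m - k))

theorem star_potentialCoeff (k : Freq p) :
    star (potentialCoeff p V k) = potentialCoeff p V (-k) := by
  unfold potentialCoeff
  simp only [star_mul', star_sum, Complex.star_def, map_inv₀, map_prod, Complex.conj_natCast,
    Complex.conj_ofReal, ← Complex.exp_conj]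
  congr 1
  refine Finset.sum_congr rfl fun n _ => ?_
  congr 1
  have key : ∀ j, ∃ c : ℤ, (k.coord j : ℂ) + ((-k).coord j : ℂ) = c := by
    intro j
    have hp : (p j : ℂ) ≠ 0 := by exact_mod_cast NeZero.ne (p j)
    have h : (((k j).val + ((-k) j).val : ℕ) : ZMod (p j)) = 0 := by
      push_cast
      simp
    obtain ⟨c, hc⟩ := (ZMod.natCast_eq_zero_iff _ _).1 h
    refine ⟨c, ?_⟩
    unfold Freq.coord
    push_cast
    rw [← add_div, div_eq_iff hp]
    have hc' : (((k j).val + ((-k) j).val : ℕ) : ℂ) = ((p j * c : ℕ) : ℂ) := by rw [hc]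
    push_cast at hc'
    rw [hc', mul_comm]
  choose c hc using key
  rw [Complex.exp_eq_exp_iff_exists_int]
  refine ⟨∑ j, c j * ((n j : ℕ) : ℤ), ?_⟩
  have hk : ∀ j, (k.coord j : ℂ) = c j - ((-k).coord j : ℂ) := fun j => by rw [← hc j]; ring
  simp only [map_neg, map_mul, map_sum, Complex.conj_I, Complex.conj_ofReal,
    Complex.conj_natCast, map_ofNat, Int.cast_sum, Int.cast_mul, Int.cast_natCast]
  simp only [hk, sub_mul, Finset.sum_sub_distrib]
  ring

theorem blochMatrix_isHermitian (x : Fin d → ℝ) : (blochMatrix p V x).IsHermitian := by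
  refine Matrix.IsHermitian.add ?_ ?_
  · exact Matrix.isHermitian_diagonal_of_self_adjoint _ (by
      ext k
      exact Complex.conj_ofReal _)
  · ext k m
    rw [Matrix.conjTranspose_apply, Matrix.of_apply, Matrix.of_apply, star_potentialCoeff, neg_sub]

/-- The eigenvalues of `Ĥ_x` in increasing order, repeated according to multiplicity;
`Fin (Fintype.card (Freq p))` has `P = p_1 ⋯ p_d` elements. (Mathlib's `eigenvalues₀` lists them
in decreasing order, whence `Fin.rev`.) -/
def blochEigenvalue (x : Fin d → ℝ) (l : Fin (Fintype.card (Freq p))) : ℝ :=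
  (blochMatrix_isHermitian p V x).eigenvalues₀ l.rev

/-- The spectrum of `Ĥ_x` is `δ`-simple: consecutive eigenvalues are at least `δ` apart. -/
def IsDeltaSimple (x : Fin d → ℝ) (δ : ℝ) : Prop :=
  ∀ l l' : Fin (Fintype.card (Freq p)), (l' : ℕ) = (l : ℕ) + 1 →
    δ ≤ blochEigenvalue p V x l' - blochEigenvalue p V x l

end PeriodicSchrodinger

end

/-!
The proof bounds from below the discriminant of the spectrum and its product with the derivatives of
all eigenvalues. Both are values of the same polynomial expression. For weights `b`, let
`g_b(e) = ∑ k, b k * adj(e - Ĥ_x) k k` (`minorSum`) and let `minorSumDet` be the product of the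
values of `g_b` over the eigenvalues. If `b = 1`, then `g_b(E_l) = ∏ m ≠ l, (E_l - E_m)`; if `b` is
the derivative of the diagonal of `Ĥ_x` in one coordinate, then `g_b(E_l)` is that product times the
derivative of `E_l` (`sum_adjugate_scalar_sub_eigenvalue`, `exists_hasDerivAt_blochEigenvalue`).

Move `x` along the diagonal, `x - (s, …, s)`, and put `y = exp (2 π i s)`. Then
`y Ĥ = diag a + y W + y² diag a'`, where `a k = ∑ j, exp (2 π i (x_j + k_j))` are phases, `a'` their
conjugates, and `W` is the matrix of the potential. Up to a unimodular factor, `minorSumDet` is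
therefore a polynomial in `y`, of degree `O(P²)` (`natDegree_minorSumDet_le`), and its value at
`y = 0` is the explicit product `∏ l, b_l ∏ m ≠ l, (a_l - a_m)` (`minorSumDet_diagonal`). The phases
are separated by `ε` off a set of measure at most `P³ ε` (`volume_phase_sub_lt_le`), since each
difference `a_l - a_m` depends on some coordinate through a term of size at least `1 / P`. Where
they are separated, factoring the polynomial over its roots shows that it is at least `ε ^ (5 P²)`
off a set of measure `O(P² ε)` (`volume_norm_eval_toCircle_lt_le`). Tonelli's theorem transfers both
one-dimensional estimates to the torus (`measure_le_of_forall_slice_le`).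

With `ε = η / (64 P³)` and crude upper bounds, `O(P)` for the eigenvalues and `(O(P²))^P` for the
minors, the lower bound of the product gives the claimed lower bound of each factor; a constant
power of `P` costs a factor `log P` in the exponent.
-/

namespace PeriodicSchrodinger
open Polynomial Matrix

/-! ### Weighted sums of diagonal minors -/

section MinorSum
variable {n R S : Type*} [Fintype n] [DecidableEq n] [CommRing R] [CommRing S]

/-- The polynomial `∑ k, b k * adj(X - M) k k`, a weighted sum of the diagonal minors of `X - M`.
By Jacobi's formula its value at `e` is the derivative of `det (e - M)` when the `k`-th diagonal
entry of `e - M` moves with velocity `b k`. -/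
noncomputable def minorSum (M : Matrix n n R) (b : n → R) : R[X] :=
  ∑ k, C (b k) * (charmatrix M).adjugate k k

/-- The product of the values of `minorSum M b` over the eigenvalues of `M`, written as the
determinant of `minorSum M b` applied to `M`. In this form it makes sense over any commutative ring
and commutes with ring homomorphisms (`minorSumDet_map`). -/
noncomputable def minorSumDet (M : Matrix n n R) (b : n → R) : R :=
  (aeval M (minorSum M b)).det

theorem minorSum_map (φ : R →+* S) (M : Matrix n n R) (b : n → R) :
    (minorSum M b).map φ = minorSum (M.map φ) (φ ∘ b) := by
  have h := (mapRingHom φ).map_adjugate (charmatrix M)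
  simp only [RingHom.mapMatrix_apply, coe_mapRingHom, ← charmatrix_map] at h
  simp [minorSum, Polynomial.map_sum, ← h]

theorem minorSumDet_map (φ : R →+* S) (M : Matrix n n R) (b : n → R) :
    φ (minorSumDet M b) = minorSumDet (M.map φ) (φ ∘ b) := by
  unfold minorSumDet
  rw [RingHom.map_det, ← minorSum_map]
  congr 1
  rw [aeval_def, hom_eval₂, aeval_def, eval₂_map]
  congr 1
  ext r i j
  simp [Matrix.algebraMap_matrix_apply, apply_ite φ]

theorem eval_minorSum (M : Matrix n n R) (b : n → R) (e : R) :
    (minorSum M b).eval e = ∑ k, b k * (scalar n e - M).adjugate k k := by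
  have h := (evalRingHom e).map_adjugate (charmatrix M)
  have h2 : (evalRingHom e).mapMatrix (charmatrix M) = scalar n e - M := by
    ext i j
    by_cases hij : i = j
    · subst hij; simp
    · simp [hij, charmatrix_apply_ne]
  rw [h2] at h
  rw [← h]
  simp [minorSum, eval_finsetSum]

theorem aeval_diagonal (a : n → R) (g : R[X]) :
    aeval (diagonal a) g = diagonal fun l => g.eval (a l) := by
  induction g using Polynomial.induction_on' with
  | add p q hp hq => simp [hp, hq]
  | monomial k c =>
    rw [aeval_monomial, diagonal_pow, Matrix.algebraMap_eq_diagonal, diagonal_mul_diagonal]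
    simp

theorem minorSumDet_diagonal (a b : n → R) :
    minorSumDet (diagonal a) b =
      ∏ l, (b l * ∏ m ∈ Finset.univ.erase l, (a l - a m)) := by
  rw [minorSumDet, aeval_diagonal, det_diagonal]
  refine Finset.prod_congr rfl fun l _ => ?_
  have h (k : n) : scalar n (a l) - diagonal a = diagonal fun i => a l - a i := by
    rw [scalar_apply, diagonal_sub]
  rw [eval_minorSum, h l, adjugate_diagonal, Finset.sum_eq_single l]
  · simp
  · intro k _ hk
    rw [diagonal_apply_eq, Finset.prod_eq_zero (i := l) (by simp [hk.symm]) (sub_self _), mul_zero]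
  · simp

end MinorSum

/-! ### Degrees for matrices of quadratic polynomials -/

section Degree
variable {n R : Type*} [Fintype n] [DecidableEq n] [CommRing R]

/-- The bivariate polynomial `p(Y)(X)` has weighted degree at most `m`, where the inner variable
`Y` has weight one and the outer variable `X` has weight two. -/
def WeightLE (m : ℕ) (p : R[X][X]) : Prop :=
  ∀ i, p.coeff i ≠ 0 → (p.coeff i).natDegree + 2 * i ≤ m

theorem WeightLE.add {m : ℕ} {p q : R[X][X]} (hp : WeightLE m p) (hq : WeightLE m q) :
    WeightLE m (p + q) := by
  intro i hi
  rw [coeff_add] at hi ⊢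
  have h := natDegree_add_le (p.coeff i) (q.coeff i)
  by_cases h1 : p.coeff i = 0
  · rw [h1, zero_add] at hi ⊢; exact hq i hi
  by_cases h2 : q.coeff i = 0
  · rw [h2, add_zero] at hi ⊢; exact hp i hi
  have := hp i h1
  have := hq i h2
  omega

theorem WeightLE.zero (m : ℕ) : WeightLE m (0 : R[X][X]) := fun i hi => absurd (coeff_zero i) hi

theorem WeightLE.sum {ι : Type*} {m : ℕ} (s : Finset ι) {f : ι → R[X][X]}
    (h : ∀ i ∈ s, WeightLE m (f i)) : WeightLE m (∑ i ∈ s, f i) :=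
  Finset.sum_induction f (WeightLE m) (fun _ _ => WeightLE.add) (.zero m) h

theorem WeightLE.mul {m k : ℕ} {p q : R[X][X]} (hp : WeightLE m p) (hq : WeightLE k q) :
    WeightLE (m + k) (p * q) := by
  intro i hi
  rw [coeff_mul] at hi ⊢
  obtain ⟨x, hx, hx0⟩ := Finset.exists_ne_zero_of_sum_ne_zero hi
  have hxi : x.1 + x.2 = i := Finset.HasAntidiagonal.mem_antidiagonal.1 hx
  have hle : 2 * i ≤ m + k := by
    have := hp _ (left_ne_zero_of_mul hx0)
    have := hq _ (right_ne_zero_of_mul hx0)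
    omega
  have : (∑ x ∈ Finset.HasAntidiagonal.antidiagonal i, p.coeff x.1 * q.coeff x.2).natDegree ≤
      m + k - 2 * i := by
    refine natDegree_sum_le_of_forall_le _ _ fun y hy => ?_
    have hyi : y.1 + y.2 = i := Finset.HasAntidiagonal.mem_antidiagonal.1 hy
    by_cases h1 : p.coeff y.1 = 0
    · simp [h1]
    by_cases h2 : q.coeff y.2 = 0
    · simp [h2]
    have := natDegree_mul_le (p := p.coeff y.1) (q := q.coeff y.2)
    have := hp _ h1
    have := hq _ h2
    omega
  omega

theorem WeightLE.C {m : ℕ} {p : R[X]} (h : p.natDegree ≤ m) : WeightLE m (C p) := by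
  intro i hi
  rw [coeff_C] at hi ⊢
  split_ifs at hi ⊢ with h0
  · omega
  · exact absurd rfl hi

theorem WeightLE.X : WeightLE 2 (X : R[X][X]) := by
  intro i hi
  rw [coeff_X] at hi ⊢
  split_ifs at hi ⊢ with h0
  · simp [← h0]
  · exact absurd rfl hi

theorem WeightLE.prod {ι : Type*} {m : ℕ} (s : Finset ι) {f : ι → R[X][X]}
    (h : ∀ i ∈ s, WeightLE m (f i)) : WeightLE (s.card * m) (∏ i ∈ s, f i) := by
  classical
  induction s using Finset.induction_on with
  | empty => simpa using WeightLE.C (R := R) (p := 1) (m := 0) (by simp)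
  | insert a s ha ih =>
    rw [Finset.prod_insert ha, Finset.card_insert_of_notMem ha, add_one_mul, add_comm]
    exact (h a (by simp)).mul (ih fun i hi => h i (by simp [hi]))

theorem WeightLE.det {m : ℕ} {A : Matrix n n R[X][X]} (h : ∀ i j, WeightLE m (A i j)) :
    WeightLE (Fintype.card n * m) A.det := by
  rw [det_apply']
  refine WeightLE.sum _ fun σ _ => ?_
  have h1 : WeightLE 0 (((Equiv.Perm.sign σ : ℤˣ) : ℤ) : R[X][X]) := by
    have : ((((Equiv.Perm.sign σ : ℤˣ) : ℤ) : R[X][X])) =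
        Polynomial.C ((((Equiv.Perm.sign σ : ℤˣ) : ℤ) : R[X])) := by simp
    rw [this]
    exact WeightLE.C (by rw [natDegree_intCast])
  simpa using h1.mul (WeightLE.prod Finset.univ fun i _ => h (σ i) i)

/-- The weight two of `X` is what makes substituting a matrix quadratic in `Y` for `X` respect
degrees. -/
theorem natDegree_aeval_apply_le {m : ℕ} {p : R[X][X]} (hp : WeightLE m p)
    {M : Matrix n n R[X]} (hM : ∀ i j, (M i j).natDegree ≤ 2) (i j : n) :
    (aeval M p i j).natDegree ≤ m := by
  have hpow (k : ℕ) : ∀ i j, ((M ^ k) i j).natDegree ≤ 2 * k := by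
    induction k with
    | zero =>
      intro i j
      rw [pow_zero, one_apply]
      split_ifs <;> simp
    | succ k ih =>
      intro i j
      rw [pow_succ, mul_apply]
      refine natDegree_sum_le_of_forall_le _ _ fun l _ => ?_
      have := natDegree_mul_le (p := (M ^ k) i l) (q := M l j)
      have := ih i l
      have := hM l j
      omega
  rw [aeval_eq_sum_range, Matrix.sum_apply]
  refine natDegree_sum_le_of_forall_le _ _ fun k _ => ?_
  rw [Matrix.smul_apply, smul_eq_mul]
  by_cases h : p.coeff k = 0
  · simp [h]
  have := natDegree_mul_le (p := p.coeff k) (q := (M ^ k) i j)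
  have := hpow k i j
  have := hp k h
  omega

theorem natDegree_det_le_of_forall_le {m : ℕ} {A : Matrix n n R[X]}
    (h : ∀ i j, (A i j).natDegree ≤ m) : A.det.natDegree ≤ Fintype.card n * m := by
  rw [det_apply']
  refine natDegree_sum_le_of_forall_le _ _ fun σ _ => ?_
  refine natDegree_mul_le.trans ?_
  rw [natDegree_intCast, zero_add]
  refine (natDegree_prod_le _ _).trans ((Finset.sum_le_card_nsmul _ _ m fun i _ => h _ _).trans ?_)
  simp

/-- The degree is quadratic in the size of the matrix. This bound is the source of the factor `P²`
in the exponent of the main estimate. -/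
theorem natDegree_minorSumDet_le {M : Matrix n n R[X]} {b : n → R[X]}
    (hM : ∀ i j, (M i j).natDegree ≤ 2) (hb : ∀ k, (b k).natDegree ≤ 2) :
    (minorSumDet M b).natDegree ≤ Fintype.card n * (2 + Fintype.card n * 2) := by
  refine natDegree_det_le_of_forall_le fun i j => natDegree_aeval_apply_le ?_ hM i j
  refine WeightLE.sum _ fun k _ => (WeightLE.C (hb k)).mul ?_
  rw [adjugate_apply]
  refine WeightLE.det fun i j => ?_
  rw [updateRow_apply]
  split_ifs
  · rw [Pi.single_apply]
    split_ifs
    · simpa using WeightLE.C (R := R) (p := 1) (m := 2) (by simp)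
    · exact .zero 2
  · have hX : WeightLE 2 (diagonal (fun _ : n => (Polynomial.X : R[X][X])) i j) := by
      rw [diagonal_apply]
      split_ifs
      · exact .X
      · exact .zero 2
    rw [charmatrix_apply, sub_eq_add_neg, ← Polynomial.C_neg]
    exact hX.add (.C (by rw [natDegree_neg]; exact hM i j))

end Degree

/-! ### Hermitian matrices and Jacobi's formula -/

section Hermitian
variable {n : Type*} [Fintype n] [DecidableEq n]

theorem det_aeval_eq_prod_eigenvalues {A : Matrix n n ℂ} (hA : A.IsHermitian) (g : ℂ[X]) :
    (aeval A g).det = ∏ i, g.eval (hA.eigenvalues i : ℂ) := by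
  conv_lhs => rw [hA.spectral_theorem]
  have h := aeval_algHom_apply (AlgHomClass.toAlgHom (Unitary.conjStarAlgAut ℂ (Matrix n n ℂ)
    hA.eigenvectorUnitary)) (diagonal (RCLike.ofReal ∘ hA.eigenvalues)) g
  simp only [AlgHom.coe_coe] at h
  rw [h, Unitary.conjStarAlgAut_apply, aeval_diagonal]
  rw [det_mul_comm, ← mul_assoc, Unitary.coe_star_mul_self, one_mul, det_diagonal]
  rfl

/-- A unimodular factor `c` multiplies the eigenvalues by `c` and the minors by a power of `c`, so
it does not change the modulus of `minorSumDet`. -/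
theorem norm_minorSumDet_smul {A : Matrix n n ℂ} (hA : A.IsHermitian) (b : n → ℂ) {c : ℂ}
    (hc : ‖c‖ = 1) :
    ‖minorSumDet (c • A) b‖ =
      ∏ i, ‖∑ k, b k * (scalar n (hA.eigenvalues i : ℂ) - A).adjugate k k‖ := by
  have h1 : aeval (c • A) (minorSum (c • A) b) =
      aeval A ((minorSum (c • A) b).comp (C c * X)) := by
    rw [aeval_comp]
    simp [Algebra.smul_def]
  rw [minorSumDet, h1, det_aeval_eq_prod_eigenvalues hA, norm_prod]
  refine Finset.prod_congr rfl fun i _ => ?_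
  have h2 : scalar n (c * (hA.eigenvalues i : ℂ)) - c • A =
      c • (scalar n (hA.eigenvalues i : ℂ) - A) := by
    rw [smul_sub]
    congr 1
    ext i j
    simp [scalar_apply, diagonal_apply]
  simp only [eval_comp, eval_mul, eval_C, eval_X, eval_minorSum, h2, adjugate_smul,
    Matrix.smul_apply, smul_eq_mul]
  simp only [mul_left_comm _ (c ^ _), ← Finset.mul_sum]
  simp [hc]

/-- Jacobi's formula for a moving diagonal. -/
theorem hasDerivAt_det_add_diagonal (A : Matrix n n ℂ) {c : ℝ → n → ℂ} {c' : n → ℂ} {t₀ : ℝ}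
    (hc : ∀ k, HasDerivAt (fun t => c t k) (c' k) t₀) :
    HasDerivAt (fun t => (A + diagonal (c t)).det)
      (∑ k, c' k * (A + diagonal (c t₀)).adjugate k k) t₀ := by
  have hent (i j : n) : HasDerivAt (fun t => (A + diagonal (c t)) i j)
      (diagonal c' i j) t₀ := by
    simp only [Matrix.add_apply]
    refine HasDerivAt.const_add _ ?_
    by_cases hij : i = j
    · subst hij; simpa using hc i
    · simpa [hij] using hasDerivAt_const t₀ (0 : ℂ)
  -- Expanding along rows matches the row update in `adjugate_apply`.
  have hdet (B : Matrix n n ℂ) : B.det = ∑ σ : Equiv.Perm n,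
      ((Equiv.Perm.sign σ : ℤˣ) : ℤ) * ∏ i, B i (σ i) := by
    rw [← det_transpose, det_apply']
    rfl
  simp only [hdet]
  have h := HasDerivAt.fun_sum (u := Finset.univ) fun (σ : Equiv.Perm n) _ =>
    (HasDerivAt.fun_finsetProd (u := Finset.univ)
      fun i _ => hent i (σ i)).const_mul (((Equiv.Perm.sign σ : ℤˣ) : ℤ) : ℂ)
  refine h.congr_deriv (Eq.symm ?_)
  simp only [Finset.mul_sum]
  rw [Finset.sum_comm]
  refine Finset.sum_congr rfl fun k _ => ?_
  rw [adjugate_apply, ← det_updateRow_smul, hdet]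
  refine Finset.sum_congr rfl fun σ _ => ?_
  congr 1
  rw [← Finset.mul_prod_erase _ _ (Finset.mem_univ k), mul_comm, smul_eq_mul]
  congr 1
  · refine Finset.prod_congr rfl fun i hi => ?_
    rw [updateRow_ne (Finset.ne_of_mem_erase hi)]
  · rw [updateRow_self, Pi.smul_apply, diagonal_apply, Pi.single_apply]
    simp only [smul_eq_mul, mul_ite, mul_one, mul_zero, eq_comm]

end Hermitian
end PeriodicSchrodinger

namespace PeriodicSchrodinger
open Polynomial MeasureTheory AddCircle
open scoped ENNReal

/-! ### Small values of polynomials on the unit circle -/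

section Circle

/-- A form of Jordan's inequality `2 |t| ≤ |sin (π t)|` for `|t| ≤ 1 / 2`. -/
theorem four_mul_norm_le_norm_toCircle_sub_one (x : UnitAddCircle) :
    4 * ‖x‖ ≤ ‖(toCircle x : ℂ) - 1‖ := by
  obtain ⟨t, rfl⟩ := QuotientAddGroup.mk_surjective x
  change 4 * ‖(t : UnitAddCircle)‖ ≤ ‖(toCircle (t : UnitAddCircle) : ℂ) - 1‖
  set s : ℝ := t - round t with hs
  have hst : (t : UnitAddCircle) = (s : UnitAddCircle) := by
    have h0 : ((round t : ℝ) : UnitAddCircle) = 0 := by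
      have := AddCircle.coe_eq_zero_iff (1 : ℝ) (x := (round t : ℝ))
      exact this.2 ⟨round t, by simp⟩
    rw [hs, AddCircle.coe_sub, h0, sub_zero]
  have hs2 : |s| ≤ 1 / 2 := abs_sub_round t
  rw [UnitAddCircle.norm_eq, ← hs, hst, toCircle_apply_mk, Circle.coe_exp,
    mul_comm (Complex.ofReal _),
    Complex.norm_exp_I_mul_ofReal_sub_one]
  have h := Real.mul_abs_le_abs_sin (x := Real.pi * s) (by
    rw [abs_mul, abs_of_pos Real.pi_pos]
    nlinarith [Real.pi_pos])
  rw [abs_mul, abs_of_pos Real.pi_pos, ← mul_assoc, div_mul_cancel₀ _ Real.pi_ne_zero] at h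
  rw [show 2 * Real.pi / 1 * s / 2 = Real.pi * s by ring, norm_mul, Real.norm_eq_abs,
    Real.norm_eq_abs, abs_two]
  linarith

theorem four_mul_norm_sub_le (x y : UnitAddCircle) :
    4 * ‖x - y‖ ≤ ‖(toCircle x : ℂ) - toCircle y‖ := by
  have h : (toCircle x : ℂ) - toCircle y = toCircle y * ((toCircle (x - y) : ℂ) - 1) := by
    have : toCircle x = toCircle y * toCircle (x - y) := by
      rw [← toCircle_add, add_sub_cancel]
    rw [this]
    push_cast
    ring
  rw [h, norm_mul, Circle.norm_coe, one_mul]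
  exact four_mul_norm_le_norm_toCircle_sub_one _

/-- If the set contains `y`, then it lies in the ball of radius `ε / 2` about `y`. -/
theorem volume_norm_toCircle_sub_lt_le (ζ : ℂ) (ε : ℝ) :
    volume {x : UnitAddCircle | ‖(toCircle x : ℂ) - ζ‖ < ε} ≤ ENNReal.ofReal ε := by
  rcases Set.eq_empty_or_nonempty {x : UnitAddCircle | ‖(toCircle x : ℂ) - ζ‖ < ε} with h | ⟨y, hy⟩
  · simp [h]
  refine (measure_mono (t := Metric.closedBall y (ε / 2)) fun x hx => ?_).trans ?_
  · rw [Metric.mem_closedBall, dist_eq_norm]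
    have h1 := four_mul_norm_sub_le x y
    have h2 := norm_sub_le_norm_sub_add_norm_sub (toCircle x : ℂ) ζ (toCircle y)
    rw [norm_sub_rev ζ] at h2
    have hx' : ‖(toCircle x : ℂ) - ζ‖ < ε := hx
    have hy' : ‖(toCircle y : ℂ) - ζ‖ < ε := hy
    linarith
  · rw [AddCircle.volume_closedBall]
    exact ENNReal.ofReal_le_ofReal ((min_le_right _ _).trans (by linarith))

/-- A Cartan-type estimate normalized at the origin: `q(y) = q(0) ∏ (1 - y / ζ)` over the roots
`ζ`, and each factor is at least `ε` off an arc of measure `2 ε`. -/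
theorem volume_norm_eval_toCircle_lt_le (q : ℂ[X]) (hq : q.eval 0 ≠ 0) {ε : ℝ} (hε : 0 < ε)
    (hε2 : ε ≤ 1 / 2) {N : ℕ} (hN : q.natDegree ≤ N) :
    volume {s : UnitAddCircle | ‖q.eval (toCircle s : ℂ)‖ < ‖q.eval 0‖ * ε ^ N} ≤
      ENNReal.ofReal (N * (2 * ε)) := by
  have hsplit := IsAlgClosed.splits q
  have hq0 : q ≠ 0 := fun h => hq (by simp [h])
  have hroot : ∀ ζ ∈ q.roots, ζ ≠ 0 := fun ζ hζ h0 => hq (by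
    have := (mem_roots hq0).1 hζ
    rwa [h0] at this)
  have hfac (y : ℂ) : q.eval y = q.eval 0 * (q.roots.map fun ζ => (1 - y / ζ)).prod := by
    rw [hsplit.eval_eq_prod_roots y, hsplit.eval_eq_prod_roots 0, mul_assoc,
      ← Multiset.prod_map_mul]
    congr 2
    refine Multiset.map_congr rfl fun ζ hζ => ?_
    have := hroot ζ hζ
    field_simp
    ring
  have hcard : q.roots.toFinset.card ≤ N :=
    (Multiset.toFinset_card_le _).trans ((card_roots' q).trans hN)
  have hsub : {s : UnitAddCircle | ‖q.eval (toCircle s : ℂ)‖ < ‖q.eval 0‖ * ε ^ N} ⊆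
      ⋃ ζ ∈ q.roots.toFinset, {s : UnitAddCircle | ‖(toCircle s : ℂ) - ζ‖ < 2 * ε} := by
    intro s hs
    by_contra hcon
    simp only [Set.mem_iUnion, Set.mem_ofPred_eq, not_exists, not_lt, Multiset.mem_toFinset] at hcon
    have hs' : ‖q.eval (toCircle s : ℂ)‖ < ‖q.eval 0‖ * ε ^ N := hs
    refine absurd hs' (not_lt.2 ?_)
    rw [hfac (toCircle s), norm_mul]
    refine mul_le_mul_of_nonneg_left ?_ (norm_nonneg _)
    have key : ∀ ζ ∈ q.roots, ε ≤ ‖1 - (toCircle s : ℂ) / ζ‖ := by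
      intro ζ hζ
      have h0 := hroot ζ hζ
      have hpos : 0 < ‖ζ‖ := norm_pos_iff.2 h0
      have h1 : 1 - (toCircle s : ℂ) / ζ = (ζ - toCircle s) / ζ := by field_simp
      rw [h1, norm_div, le_div_iff₀ hpos]
      have h2 := hcon ζ hζ
      rw [norm_sub_rev] at h2
      have h3 := norm_sub_norm_le ζ (toCircle s : ℂ)
      rw [Circle.norm_coe] at h3
      -- Only roots of modulus at most two come close to the circle relative to their size.
      rcases le_total ‖ζ‖ 2 with h | h
      · nlinarith
      · nlinarith
    calc ε ^ N ≤ ε ^ (Multiset.card q.roots) :=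
          pow_le_pow_of_le_one hε.le (by linarith) ((card_roots' q).trans hN)
      _ = (q.roots.map fun _ => ε).prod := by simp
      _ ≤ (q.roots.map fun ζ => ‖1 - (toCircle s : ℂ) / ζ‖).prod :=
          Multiset.prod_map_le_prod_map₀ _ _ (fun _ _ => hε.le) key
      _ = ‖(q.roots.map fun ζ => 1 - (toCircle s : ℂ) / ζ).prod‖ := by
          have := map_multiset_prod (normHom (α := ℂ))
            (q.roots.map fun ζ => 1 - (toCircle s : ℂ) / ζ)
          rw [Multiset.map_map] at this
          exact this.symm
  refine (measure_mono hsub).trans ((measure_biUnion_finset_le _ _).trans ?_)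
  refine (Finset.sum_le_sum fun ζ _ => volume_norm_toCircle_sub_lt_le ζ (2 * ε)).trans ?_
  rw [Finset.sum_const, nsmul_eq_mul,
    ENNReal.ofReal_mul (p := (N : ℝ)) (by positivity), ENNReal.ofReal_natCast]
  gcongr

end Circle

/-! ### Slicing a set along a family of translations -/

section Slices
variable {G H : Type*} [AddCommGroup G] [MeasurableSpace G] [MeasurableAdd₂ G]
  [MeasurableSpace H]

/-- By Tonelli's theorem and translation invariance, `μ B` is the average over `x` of the measures
of the slices `{s | φ s + x ∈ B}`. -/
theorem measure_le_of_forall_slice_le {μ : Measure G} [IsProbabilityMeasure μ]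
    [μ.IsAddLeftInvariant] {ν : Measure H} [IsProbabilityMeasure ν] {φ : H → G}
    (hφ : Measurable φ) {B : Set G} (hB : MeasurableSet B) {c : ℝ≥0∞}
    (hc : ∀ x, ν {s | φ s + x ∈ B} ≤ c) : μ B ≤ c := by
  have hm : MeasurableSet {z : H × G | φ z.1 + z.2 ∈ B} :=
    ((hφ.comp measurable_fst).add measurable_snd) hB
  have h1 : (ν.prod μ) {z : H × G | φ z.1 + z.2 ∈ B} = μ B := by
    rw [Measure.prod_apply hm]
    have (s : H) : μ (Prod.mk s ⁻¹' {z : H × G | φ z.1 + z.2 ∈ B}) = μ B :=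
      measure_preimage_add μ (φ s) B
    simp only [this, lintegral_const, measure_univ, mul_one]
  rw [← h1, Measure.prod_apply_symm hm]
  calc _ ≤ ∫⁻ _, c ∂μ := lintegral_mono fun x => hc x
    _ = c := by simp

end Slices
end PeriodicSchrodinger

namespace PeriodicSchrodinger
open Polynomial Matrix Filter Topology

/-! ### Ordered eigenvalues -/

section Eigenvalues
variable {n : Type*} [Fintype n] [DecidableEq n] {A : Matrix n n ℂ} (hA : A.IsHermitian)

theorem exists_equiv_eigenvalues : ∃ e : Fin (Fintype.card n) ≃ n,
    ∀ l, hA.eigenvalues (e l) = hA.eigenvalues₀ l.rev :=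
  ⟨Fin.revPerm.trans (Fintype.equivOfCardEq (Fintype.card_fin _)), fun l => by
    simp [IsHermitian.eigenvalues]⟩

theorem det_scalar_sub_eq_prod (e : ℂ) :
    (scalar n e - A).det = ∏ l : Fin (Fintype.card n), (e - (hA.eigenvalues₀ l.rev : ℂ)) := by
  obtain ⟨f, hf⟩ := exists_equiv_eigenvalues hA
  rw [← eval_charpoly, hA.charpoly_eq, eval_prod, ← f.prod_comp]
  simp [hf]

/-- Both sides are the derivative at the eigenvalue of `e ↦ det (e - A)`, computed by Jacobi's
formula and from the factorization over the eigenvalues. -/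
theorem sum_adjugate_scalar_sub_eigenvalue (l : Fin (Fintype.card n)) :
    ∑ k, (scalar n (hA.eigenvalues₀ l.rev : ℂ) - A).adjugate k k =
      ∏ m ∈ Finset.univ.erase l, ((hA.eigenvalues₀ l.rev : ℂ) - hA.eigenvalues₀ m.rev) := by
  have h1 := hasDerivAt_det_add_diagonal (-A) (t₀ := hA.eigenvalues₀ l.rev)
    (c := fun t _ => (t : ℂ)) (c' := fun _ => 1) fun _ => Complex.ofRealCLM.hasDerivAt
  have h2 : HasDerivAt
      (fun t : ℝ => ∏ m : Fin (Fintype.card n), ((t : ℂ) - (hA.eigenvalues₀ m.rev : ℂ)))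
      (∑ m : Fin (Fintype.card n), (∏ j ∈ Finset.univ.erase m,
        ((hA.eigenvalues₀ l.rev : ℂ) - (hA.eigenvalues₀ j.rev : ℂ))) • (1 : ℂ))
      (hA.eigenvalues₀ l.rev) :=
    HasDerivAt.fun_finsetProd fun m _ => Complex.ofRealCLM.hasDerivAt.sub_const _
  have hs (t : ℝ) : -A + diagonal (fun _ => (t : ℂ)) = scalar n (t : ℂ) - A := by
    rw [scalar_apply, neg_add_eq_sub]
  simp only [hs, det_scalar_sub_eq_prod hA, one_mul] at h1
  rw [h1.unique h2, Finset.sum_eq_single l]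
  · simp
  · intro m _ hm
    rw [Finset.prod_eq_zero (i := l) (by simp [hm.symm]) (sub_self _), zero_smul]
  · simp

theorem norm_minorSumDet_smul_eq_prod (b : n → ℂ) {c : ℂ} (hc : ‖c‖ = 1) :
    ‖minorSumDet (c • A) b‖ = ∏ l : Fin (Fintype.card n),
      ‖∑ k, b k * (scalar n (hA.eigenvalues₀ l.rev : ℂ) - A).adjugate k k‖ := by
  obtain ⟨f, hf⟩ := exists_equiv_eigenvalues hA
  rw [norm_minorSumDet_smul hA b hc, ← f.prod_comp]
  simp [hf]

theorem abs_eigenvalues₀_le {K : ℝ} (hK : ∀ i, ∑ j, ‖A i j‖ ≤ K) (l : Fin (Fintype.card n)) :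
    |hA.eigenvalues₀ l.rev| ≤ K := by
  obtain ⟨f, hf⟩ := exists_equiv_eigenvalues hA
  have h : Module.End.HasEigenvalue (Matrix.toLin' A) (hA.eigenvalues (f l) : ℂ) := by
    rw [Module.End.hasEigenvalue_iff_mem_spectrum, spectrum_toLin', hA.spectrum_eq_image_range]
    exact ⟨_, ⟨_, rfl⟩, rfl⟩
  obtain ⟨k, hk⟩ := eigenvalue_mem_ball h
  rw [Metric.mem_closedBall, dist_eq_norm] at hk
  rw [← hf, ← Real.norm_eq_abs, ← Complex.norm_real]
  refine le_trans ?_ (hK k)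
  rw [← Finset.add_sum_erase _ _ (Finset.mem_univ k)]
  have := norm_sub_norm_le (hA.eigenvalues (f l) : ℂ) (A k k)
  linarith

end Eigenvalues

theorem norm_adjugate_apply_self_le {n : Type*} [Fintype n] [DecidableEq n] {B : Matrix n n ℂ}
    {K : ℝ} (hK : 1 ≤ K) (hB : ∀ i j, ‖B i j‖ ≤ K) (k : n) :
    ‖B.adjugate k k‖ ≤ (Fintype.card n * K) ^ Fintype.card n := by
  rw [adjugate_apply]
  have h := det_le (A := B.updateRow k (Pi.single k 1)) (abv := IsAbsoluteValue.toAbsoluteValue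
    (norm : ℂ → ℝ)) (x := K) (fun i j => by
      change ‖B.updateRow k (Pi.single k 1) i j‖ ≤ K
      rw [updateRow_apply]
      split_ifs
      · rw [Pi.single_apply]
        split_ifs
        · simpa using hK
        · simpa using zero_le_one.trans hK
      · exact hB i j)
  refine le_trans h ?_
  rw [nsmul_eq_mul, mul_pow]
  gcongr
  exact_mod_cast Nat.factorial_le_pow _

/-! ### Differentiability of simple roots -/

section Derivative

/-- Ordered roots depend continuously on the polynomial at a polynomial with simple roots: if
`∏ k, (E₀ l - E t k)` is small, then some `E t k` is close to `E₀ l`, and matching roots in this way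
preserves the order, hence is the identity on `Fin P`. -/
theorem tendsto_of_tendsto_prod {ι : Type*} {F : Filter ι} {P : ℕ} {E : ι → Fin P → ℝ}
    (hmono : ∀ t, Monotone (E t)) {E₀ : Fin P → ℝ} (hE₀ : StrictMono E₀)
    (hprod : ∀ l, Tendsto (fun t => ∏ k, (E₀ l - E t k)) F (𝓝 0)) (l : Fin P) :
    Tendsto (fun t => E t l) F (𝓝 (E₀ l)) := by
  rw [Metric.tendsto_nhds]
  intro ε hε
  obtain ⟨δ, hδ, hδε, hgap⟩ : ∃ δ > 0, δ ≤ ε ∧ ∀ l m, l < m → 2 * δ ≤ E₀ m - E₀ l := by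
    have h : ∀ᶠ δ in 𝓝[>] (0 : ℝ), ∀ l m, l < m → 2 * δ ≤ E₀ m - E₀ l := by
      refine eventually_all.2 fun l => eventually_all.2 fun m => eventually_imp_distrib_left.2
        fun hlm => ?_
      have : ∀ᶠ δ in 𝓝 (0 : ℝ), 2 * δ < E₀ m - E₀ l :=
        (continuous_const.mul continuous_id).tendsto' 0 0 (by simp) |>.eventually_lt_const
          (sub_pos.2 (hE₀ hlm))
      exact (this.filter_mono nhdsWithin_le_nhds).mono fun _ h => h.le
    obtain ⟨δ, h1, h2, h3⟩ := (h.and (Ioc_mem_nhdsGT hε)).exists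
    exact ⟨δ, h2, h3, h1⟩
  have hev : ∀ᶠ t in F, ∀ l, |∏ k, (E₀ l - E t k)| < δ ^ P := by
    refine eventually_all.2 fun l => ?_
    have := (hprod l).abs
    rw [abs_zero] at this
    exact this.eventually_lt_const (by positivity)
  filter_upwards [hev] with t ht
  have hclose : ∀ l, ∃ k, |E₀ l - E t k| < δ := by
    intro l
    by_contra! hcon
    refine absurd (ht l) (not_lt.2 ?_)
    rw [Finset.abs_prod]
    calc δ ^ P = ∏ _k : Fin P, δ := by simp
      _ ≤ _ := Finset.prod_le_prod (fun _ _ => hδ.le) fun k _ => hcon k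
  choose σ hσ using hclose
  have hσmono : StrictMono σ := by
    intro a b hab
    by_contra! hcon
    have h1 := hmono t hcon
    have h2 := abs_lt.1 (hσ a)
    have h3 := abs_lt.1 (hσ b)
    have := hgap a b hab
    linarith
  have hid : σ l = l := le_antisymm hσmono.apply_le hσmono.le_apply
  have := hσ l
  rw [hid, abs_sub_comm] at this
  exact this.trans_le hδε

/-- Implicit differentiation of a simple root. With `h t = ∏ m ≠ l, (E t₀ l - E t m)`, which is
continuous and nonzero at `t₀`, the given product equals `(E t₀ l - E t l) * h t`; dividing its
difference quotient by `h` gives that of the root. -/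
theorem exists_hasDerivAt_of_hasDerivAt_prod {P : ℕ} {E : ℝ → Fin P → ℝ}
    (hmono : ∀ t, Monotone (E t)) {t₀ : ℝ} (hE₀ : StrictMono (E t₀)) {D : Fin P → ℂ}
    (hD : ∀ l, HasDerivAt (fun t => ∏ k, ((E t₀ l : ℂ) - E t k)) (D l) t₀) (l : Fin P) :
    ∃ D', HasDerivAt (fun t => E t l) D' t₀ ∧
      ‖D l‖ = |D'| * ∏ m ∈ Finset.univ.erase l, |E t₀ l - E t₀ m| := by
  have hDre (l : Fin P) : HasDerivAt (fun t => ∏ k, (E t₀ l - E t k)) (D l).re t₀ := by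
    have h := Complex.reCLM.hasFDerivAt.comp_hasDerivAt t₀ (hD l)
    refine h.congr_of_eventuallyEq (.of_forall fun t => ?_)
    change ∏ k, (E t₀ l - E t k) = (∏ k, ((E t₀ l : ℂ) - E t k)).re
    rw [← Complex.ofReal_re (∏ k, (E t₀ l - E t k))]
    push_cast
    rfl
  have hDeq : D l = ((D l).re : ℂ) := by
    refine (hD l).unique ?_
    convert! (hDre l).ofReal_comp using 2
    push_cast
    rfl
  have hzero (l : Fin P) : ∏ k, (E t₀ l - E t₀ k) = 0 :=
    Finset.prod_eq_zero (Finset.mem_univ l) (sub_self _)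
  have hcont := tendsto_of_tendsto_prod hmono hE₀ fun l => by
    simpa only [hzero] using (hDre l).continuousAt.tendsto
  set h : ℝ → ℝ := fun t => ∏ m ∈ Finset.univ.erase l, (E t₀ l - E t m) with hh
  have hne : h t₀ ≠ 0 := Finset.prod_ne_zero_iff.2 fun m hm =>
    sub_ne_zero.2 fun he => Finset.ne_of_mem_erase hm (hE₀.injective he).symm
  have hlim : Tendsto h (𝓝 t₀) (𝓝 (h t₀)) :=
    tendsto_finsetProd _ fun m _ => tendsto_const_nhds.sub (hcont m)
  refine ⟨-((D l).re / h t₀), ?_, ?_⟩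
  · rw [hasDerivAt_iff_tendsto_slope]
    have hs := (((hasDerivAt_iff_tendsto_slope.1 (hDre l)).div
      (hlim.mono_left nhdsWithin_le_nhds) hne)).neg
    refine hs.congr' ?_
    have hev : ∀ᶠ t in 𝓝[≠] t₀, h t ≠ 0 :=
      (hlim.eventually_ne hne).filter_mono nhdsWithin_le_nhds
    filter_upwards [hev] with t ht
    rw [Pi.div_apply, slope_def_field, slope_def_field, hzero,
      ← Finset.mul_prod_erase _ _ (Finset.mem_univ l)]
    change -((((E t₀ l - E t l) * h t - 0) / (t - t₀)) / h t) = _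
    rw [sub_zero, div_right_comm, mul_div_cancel_right₀ _ ht, ← neg_div, neg_sub]
  · rw [hDeq, Complex.norm_real, Real.norm_eq_abs, ← Finset.abs_prod, ← abs_mul]
    change |(D l).re| = |-((D l).re / h t₀) * h t₀|
    rw [neg_mul, div_mul_cancel₀ _ hne, abs_neg]

end Derivative
end PeriodicSchrodinger

namespace PeriodicSchrodinger
open Polynomial Matrix MeasureTheory AddCircle
open scoped ENNReal

instance : IsProbabilityMeasure (volume : Measure UnitAddCircle) := ⟨UnitAddCircle.measure_univ⟩

/-! ### Small values of `minorSumDet` along the diagonal of the torus -/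

section Torus
variable {d : ℕ} {n : Type*} [DecidableEq n]

theorem minorSumDet_continuousMap_apply [Fintype n] {T : Type*} [TopologicalSpace T]
    (M : Matrix n n C(T, ℂ)) (b : n → C(T, ℂ)) (θ : T) :
    minorSumDet M b θ = minorSumDet (M.map fun f => f θ) fun k => b k θ :=
  minorSumDet_map ((Pi.evalRingHom (fun _ : T => ℂ) θ).comp ContinuousMap.coeFnRingHom) M b

/-- Evaluate `minorSumDet` in the ring `C(T, ℂ)`: the result is a continuous function with the
required values. -/
theorem continuous_minorSumDet [Fintype n] {T : Type*} [TopologicalSpace T] {M : T → Matrix n n ℂ}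
    {b : T → n → ℂ} (hM : ∀ i j, Continuous fun θ => M θ i j)
    (hb : ∀ k, Continuous fun θ => b θ k) :
    Continuous fun θ => minorSumDet (M θ) (b θ) := by
  have h := (minorSumDet (Matrix.of fun i j => (⟨_, hM i j⟩ : C(T, ℂ)))
    fun k => ⟨_, hb k⟩).continuous
  refine h.congr fun θ => ?_
  rw [minorSumDet_continuousMap_apply]
  rfl

/-- The quadratic matrix polynomial `diag a + Y W + Y² diag a'`. For `|y| = 1` its value at `y` is
`y` times the matrix `diag (y⁻¹ a + y a') + W`. -/
noncomputable def pencil (a a' : n → ℂ) (W : Matrix n n ℂ) : Matrix n n ℂ[X] :=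
  diagonal (fun k => C (a k) + C (a' k) * X ^ 2) + W.map fun w => C w * X

theorem natDegree_pencil_le (a a' : n → ℂ) (W : Matrix n n ℂ) (i j : n) :
    (pencil a a' W i j).natDegree ≤ 2 := by
  rw [pencil, Matrix.add_apply, map_apply, diagonal_apply]
  split_ifs <;> compute_degree!

theorem pencil_map_eval (a a' : n → ℂ) (W : Matrix n n ℂ) (y : ℂ) :
    (pencil a a' W).map (evalRingHom y) = diagonal (fun k => a k + a' k * y ^ 2) + y • W := by
  ext i j
  by_cases h : i = j
  · subst h; simp [pencil, mul_comm y]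
  · simp [pencil, h, mul_comm y]

/-- At `Y = 0` the pencil is `diag a`, for which `minorSumDet` is explicit; it is large if the `a k`
are separated. -/
theorem pow_le_norm_eval_zero_minorSumDet [Fintype n] {a a' : n → ℂ} {W : Matrix n n ℂ}
    {β : n → ℂ[X]} (hβ : ∀ k, 1 ≤ ‖(β k).eval 0‖) {ε : ℝ} (hε : 0 < ε) (hε1 : ε ≤ 1)
    (ha : ∀ k m, k ≠ m → ε ≤ ‖a k - a m‖) :
    ε ^ (Fintype.card n ^ 2) ≤ ‖(minorSumDet (pencil a a' W) β).eval 0‖ := by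
  have h := minorSumDet_map (evalRingHom (0 : ℂ)) (pencil a a' W) β
  rw [pencil_map_eval] at h
  simp only [ne_eq, OfNat.ofNat_ne_zero, not_false_eq_true, zero_pow, mul_zero, add_zero,
    zero_smul, minorSumDet_diagonal] at h
  rw [← coe_evalRingHom, h, norm_prod, sq, pow_mul]
  calc (ε ^ Fintype.card n) ^ Fintype.card n = ∏ _l : n, ε ^ Fintype.card n := by simp
    _ ≤ _ := Finset.prod_le_prod (fun _ _ => by positivity) fun l _ => ?_
  rw [norm_mul, norm_prod]
  calc ε ^ Fintype.card n ≤ ε ^ (Finset.univ.erase l).card :=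
        pow_le_pow_of_le_one hε.le hε1 (Finset.card_le_univ _)
    _ = 1 * ∏ _m ∈ Finset.univ.erase l, ε := by simp
    _ ≤ _ := mul_le_mul (hβ l) (Finset.prod_le_prod (fun _ _ => hε.le) fun m hm =>
        ha l m (Finset.ne_of_mem_erase hm).symm) (by positivity) (norm_nonneg _)

/-- Let `diag (a θ + a' θ) + W` be Hermitian, where a diagonal translation of `θ` by `s` multiplies
`a` by `e(s)` and `a'` by `e(-s)`. On the diagonal line through `θ`, `|minorSumDet|` is the modulus
of a polynomial on the unit circle, whose value at the origin is large where the `a θ k` are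
separated. The separation is constant along the line, so small values are rare on each line. -/
theorem volume_separated_minorSumDet_lt_le [Fintype n] {a a' : (Fin d → UnitAddCircle) → n → ℂ}
    {W : Matrix n n ℂ} {b : (Fin d → UnitAddCircle) → n → ℂ}
    (hac : ∀ k, Continuous fun θ => a θ k) (hac' : ∀ k, Continuous fun θ => a' θ k)
    (hbc : ∀ k, Continuous fun θ => b θ k)
    (hH : ∀ θ, (diagonal (a θ + a' θ) + W).IsHermitian)
    (ha : ∀ θ s k, toCircle s * a ((fun _ => -s) + θ) k = a θ k)
    (ha' : ∀ θ s k, a' ((fun _ => -s) + θ) k = toCircle s * a' θ k)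
    (hb : ∀ θ, ∃ β : n → ℂ[X], (∀ k, (β k).natDegree ≤ 2) ∧ (∀ k, 1 ≤ ‖(β k).eval 0‖) ∧
      ∀ s, ∃ c : ℂ, ‖c‖ = 1 ∧ ∀ k, c * b ((fun _ => -s) + θ) k = (β k).eval (toCircle s : ℂ))
    {ε : ℝ} (hε : 0 < ε) (hε2 : ε ≤ 1 / 2) {N : ℕ}
    (hN : Fintype.card n * (2 + Fintype.card n * 2) ≤ N) :
    MeasurableSet {θ | (∀ k m, k ≠ m → ε ≤ ‖a θ k - a θ m‖) ∧
        ‖minorSumDet (diagonal (a θ + a' θ) + W) (b θ)‖ < ε ^ (Fintype.card n ^ 2 + N)} ∧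
    volume {θ | (∀ k m, k ≠ m → ε ≤ ‖a θ k - a θ m‖) ∧
        ‖minorSumDet (diagonal (a θ + a' θ) + W) (b θ)‖ < ε ^ (Fintype.card n ^ 2 + N)} ≤
      ENNReal.ofReal (N * (2 * ε)) := by
  have hmeas : MeasurableSet {θ | (∀ k m, k ≠ m → ε ≤ ‖a θ k - a θ m‖) ∧
      ‖minorSumDet (diagonal (a θ + a' θ) + W) (b θ)‖ < ε ^ (Fintype.card n ^ 2 + N)} := by
    have hc : Continuous fun θ => minorSumDet (diagonal (a θ + a' θ) + W) (b θ) := by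
      refine continuous_minorSumDet (fun i j => ?_) hbc
      simp only [Matrix.add_apply, diagonal_apply, Pi.add_apply]
      refine Continuous.add ?_ continuous_const
      split_ifs
      · exact (hac i).add (hac' i)
      · exact continuous_const
    have hset : {θ | (∀ k m, k ≠ m → ε ≤ ‖a θ k - a θ m‖) ∧
        ‖minorSumDet (diagonal (a θ + a' θ) + W) (b θ)‖ < ε ^ (Fintype.card n ^ 2 + N)} =
        (⋂ k, ⋂ m, ⋂ _ : k ≠ m, {θ | ε ≤ ‖a θ k - a θ m‖}) ∩
        {θ | ‖minorSumDet (diagonal (a θ + a' θ) + W) (b θ)‖ < ε ^ (Fintype.card n ^ 2 + N)} := by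
      ext θ
      simp
    rw [hset]
    refine MeasurableSet.inter ?_ (measurableSet_lt hc.norm.measurable measurable_const)
    exact MeasurableSet.iInter fun k => MeasurableSet.iInter fun m => MeasurableSet.iInter fun _ =>
      measurableSet_le measurable_const ((hac k).sub (hac m)).norm.measurable
  refine ⟨hmeas, measure_le_of_forall_slice_le (ν := (volume : Measure UnitAddCircle))
    (φ := fun s _ => -s) (by fun_prop) hmeas fun θ => ?_⟩
  have hnorm (s : UnitAddCircle) (k m : n) :
      ‖a ((fun _ => -s) + θ) k - a ((fun _ => -s) + θ) m‖ = ‖a θ k - a θ m‖ := by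
    rw [← ha θ s k, ← ha θ s m, ← mul_sub, norm_mul, Circle.norm_coe, one_mul]
  -- On a line without separation the slice is empty.
  by_cases hsep : ∀ k m, k ≠ m → ε ≤ ‖a θ k - a θ m‖
  swap
  · refine (measure_mono (t := ∅) fun s hs => hsep fun k m hkm => ?_).trans (by simp)
    rw [← hnorm s]
    exact hs.1 k m hkm
  obtain ⟨β, hβdeg, hβ0, hβ⟩ := hb θ
  set q := minorSumDet (pencil (a θ) (a' θ) W) β with hq
  have hq0 := pow_le_norm_eval_zero_minorSumDet (a' := a' θ) (W := W) hβ0 hε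
    (hε2.trans (by norm_num)) hsep
  have hqne : q.eval 0 ≠ 0 := norm_pos_iff.1 (lt_of_lt_of_le (by positivity) hq0)
  refine (measure_mono fun s hs => ?_).trans (volume_norm_eval_toCircle_lt_le q hqne hε hε2
    ((natDegree_minorSumDet_le (natDegree_pencil_le _ _ _) hβdeg).trans hN))
  obtain ⟨c, hc, hcb⟩ := hβ s
  have heval : ‖q.eval (toCircle s : ℂ)‖ =
      ‖minorSumDet (diagonal (a ((fun _ => -s) + θ) + a' ((fun _ => -s) + θ)) + W)
        (b ((fun _ => -s) + θ))‖ := by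
    have h := minorSumDet_map (evalRingHom (toCircle s : ℂ)) (pencil (a θ) (a' θ) W) β
    have hmat : (pencil (a θ) (a' θ) W).map (evalRingHom (toCircle s : ℂ)) = (toCircle s : ℂ) •
        (diagonal (a ((fun _ => -s) + θ) + a' ((fun _ => -s) + θ)) + W) := by
      rw [pencil_map_eval, smul_add]
      congr 1
      rw [← diagonal_smul]
      congr 1
      ext k
      rw [Pi.smul_apply, Pi.add_apply, smul_eq_mul, mul_add, ha, ha']
      ring
    have hvec : evalRingHom (toCircle s : ℂ) ∘ β = c • b ((fun _ => -s) + θ) := by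
      ext k
      exact (hcb k).symm
    rw [hmat, hvec] at h
    have h1 := norm_minorSumDet_smul (hH ((fun _ => -s) + θ)) (b ((fun _ => -s) + θ)) norm_one
    rw [one_smul] at h1
    rw [← coe_evalRingHom, h, norm_minorSumDet_smul (hH _) _ (Circle.norm_coe _), h1]
    refine Finset.prod_congr rfl fun i _ => ?_
    simp only [Pi.smul_apply, smul_eq_mul, mul_assoc, ← Finset.mul_sum, norm_mul, hc, one_mul]
  change ‖q.eval (toCircle s : ℂ)‖ < ‖q.eval 0‖ * ε ^ N
  rw [heval]
  refine lt_of_lt_of_le hs.2 ?_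
  rw [pow_add]
  gcongr

end Torus
end PeriodicSchrodinger

namespace PeriodicSchrodinger
open Polynomial Matrix MeasureTheory AddCircle
open scoped ENNReal

/-! ### Bloch matrices on the torus -/

section Bloch
variable {d : ℕ} (p : Fin d → ℕ) (V : (Fin d → ℤ) → ℝ)

/-- The `j`-th coordinate of a point of `𝔹_p`, as an element of `ℝ / ℤ`. -/
noncomputable def Freq.point {p : Fin d → ℕ} (k : Freq p) (j : Fin d) : UnitAddCircle :=
  (k.coord j : ℝ)

/-- The part `∑ j, exp (2 π i (θ_j + k_j))` of the `k`-th diagonal entry of the Bloch matrix that is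
homogeneous of degree one under diagonal translations. -/
noncomputable def phase (θ : Fin d → UnitAddCircle) (k : Freq p) : ℂ :=
  ∑ j, (toCircle (θ j + k.point j) : ℂ)

/-- The complex conjugate `∑ j, exp (-2 π i (θ_j + k_j))` of `phase`, the other part of the `k`-th
diagonal entry. -/
noncomputable def conjPhase (θ : Fin d → UnitAddCircle) (k : Freq p) : ℂ :=
  ∑ j, (toCircle (-(θ j + k.point j)) : ℂ)

/-- The derivative in the `j`-th coordinate of the `k`-th diagonal entry `phase + conjPhase` of the
Bloch matrix. -/
noncomputable def phaseDeriv (j : Fin d) (θ : Fin d → UnitAddCircle) (k : Freq p) : ℂ :=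
  2 * Real.pi * Complex.I *
    ((toCircle (θ j + k.point j) : ℂ) - toCircle (-(θ j + k.point j)))

theorem toCircle_coe_eq_cexp (t : ℝ) :
    (toCircle (t : UnitAddCircle) : ℂ) = Complex.exp (((2 * Real.pi * t : ℝ) : ℂ) * Complex.I) := by
  rw [toCircle_apply_mk, Circle.coe_exp, div_one]

theorem phase_add_conjPhase_coe (x : Fin d → ℝ) (k : Freq p) :
    phase p (fun j => (x j : UnitAddCircle)) k + conjPhase p (fun j => (x j : UnitAddCircle)) k =
      ((∑ j, 2 * Real.cos (2 * Real.pi * (x j + k.coord j)) : ℝ) : ℂ) := by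
  rw [phase, conjPhase, ← Finset.sum_add_distrib, Complex.ofReal_sum]
  refine Finset.sum_congr rfl fun j _ => ?_
  rw [Freq.point, ← AddCircle.coe_add, ← AddCircle.coe_neg, toCircle_coe_eq_cexp,
    toCircle_coe_eq_cexp, mul_neg, Complex.ofReal_neg, ← Complex.two_cos, ← Complex.ofReal_cos]
  push_cast
  ring

theorem phaseDeriv_coe (j : Fin d) (x : Fin d → ℝ) (k : Freq p) :
    phaseDeriv p j (fun j => (x j : UnitAddCircle)) k =
      ((-(4 * Real.pi * Real.sin (2 * Real.pi * (x j + k.coord j))) : ℝ) : ℂ) := by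
  have h := Complex.two_sin ((2 * Real.pi * (x j + k.coord j) : ℝ) : ℂ)
  rw [phaseDeriv, Freq.point, ← AddCircle.coe_add, ← AddCircle.coe_neg, toCircle_coe_eq_cexp,
    toCircle_coe_eq_cexp, mul_neg, Complex.ofReal_neg]
  have h2 (u : ℝ) : ((-(4 * Real.pi * Real.sin u) : ℝ) : ℂ) =
      -(2 * Real.pi * (2 * Complex.sin u)) := by
    push_cast
    ring
  rw [h2, h]
  ring

theorem continuous_toCircle_coe {T : Type*} [TopologicalSpace T] {f : T → UnitAddCircle}
    (hf : Continuous f) : Continuous fun θ => (toCircle (f θ) : ℂ) :=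
  continuous_subtype_val.comp (continuous_toCircle.comp hf)

theorem continuous_phase (k : Freq p) : Continuous fun θ => phase p θ k :=
  continuous_finsetSum _ fun j _ => continuous_toCircle_coe (by fun_prop)

theorem continuous_conjPhase (k : Freq p) : Continuous fun θ => conjPhase p θ k :=
  continuous_finsetSum _ fun j _ => continuous_toCircle_coe (by fun_prop)

theorem continuous_phaseDeriv (j : Fin d) (k : Freq p) : Continuous fun θ => phaseDeriv p j θ k :=
  continuous_const.mul ((continuous_toCircle_coe (by fun_prop)).sub
    (continuous_toCircle_coe (by fun_prop)))

theorem toCircle_neg_add (s x : UnitAddCircle) :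
    (toCircle s : ℂ) * toCircle (-s + x) = toCircle x := by
  rw [← Circle.coe_mul, ← toCircle_add, add_neg_cancel_left]

theorem toCircle_mul_phase (θ : Fin d → UnitAddCircle) (s : UnitAddCircle) (k : Freq p) :
    toCircle s * phase p ((fun _ => -s) + θ) k = phase p θ k := by
  simp only [phase, Finset.mul_sum, Pi.add_apply, add_assoc, toCircle_neg_add]

theorem toCircle_neg_neg_add (s x y : UnitAddCircle) :
    (toCircle (-(-s + x + y)) : ℂ) = toCircle s * toCircle (-(x + y)) := by
  rw [← Circle.coe_mul, ← toCircle_add]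
  congr 2
  abel

theorem conjPhase_neg_add (θ : Fin d → UnitAddCircle) (s : UnitAddCircle) (k : Freq p) :
    conjPhase p ((fun _ => -s) + θ) k = toCircle s * conjPhase p θ k := by
  simp only [conjPhase, Finset.mul_sum, Pi.add_apply, toCircle_neg_neg_add]

theorem inv_le_norm_coe_div {q : ℕ} (hq : 0 < q) {z : ℤ} (hz : z ≠ 0) (hzq : |z| < q) :
    (q : ℝ)⁻¹ ≤ ‖(((z : ℝ) / q : ℝ) : UnitAddCircle)‖ := by
  have hq' : (0 : ℝ) < q := by exact_mod_cast hq
  rw [UnitAddCircle.norm_eq]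
  set r := round ((z : ℝ) / q)
  have h : (z : ℝ) / q - r = ((z - q * r : ℤ) : ℝ) / q := by
    push_cast
    field_simp
  rw [h, abs_div, abs_of_pos hq', ← one_div]
  gcongr
  rw [← Int.cast_abs]
  have hne : z - q * r ≠ 0 := fun h0 => hz (Int.eq_zero_of_abs_lt_dvd ⟨r, by linarith⟩ hzq)
  exact_mod_cast Int.one_le_abs hne

theorem blochMatrix_eq (x : Fin d → ℝ) :
    blochMatrix p V x = diagonal (phase p (fun j => (x j : UnitAddCircle)) +
      conjPhase p (fun j => (x j : UnitAddCircle))) +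
      Matrix.of (fun k m => potentialCoeff p V (m - k)) := by
  rw [blochMatrix]
  congr 2
  ext k
  exact (phase_add_conjPhase_coe p x k).symm

variable [∀ j, NeZero (p j)]

theorem inv_card_le_norm_coord_sub {k m : Freq p} {j : Fin d} (h : k j ≠ m j) :
    (Fintype.card (Freq p) : ℝ)⁻¹ ≤ ‖((k.coord j - m.coord j : ℝ) : UnitAddCircle)‖ := by
  have hpos : 0 < p j := NeZero.pos (p j)
  have hcard : p j ≤ Fintype.card (Freq p) := by
    rw [Fintype.card_pi]
    simp only [ZMod.card]
    exact Finset.single_le_prod' (f := p) (fun i _ => NeZero.one_le) (Finset.mem_univ j)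
  have hz : ((k j).val : ℤ) - (m j).val ≠ 0 := fun h0 =>
    h (ZMod.val_injective _ (by omega))
  have h1 := ZMod.val_lt (k j)
  have h2 := ZMod.val_lt (m j)
  have key := inv_le_norm_coe_div hpos hz (by rw [abs_lt]; omega)
  have heq : k.coord j - m.coord j = (((((k j).val : ℤ) - (m j).val : ℤ) : ℝ) / p j) := by
    simp [Freq.coord, sub_div]
  rw [heq]
  refine le_trans ?_ key
  gcongr

/-- If `k` and `m` differ in the coordinate `j`, then along the `j`-th coordinate circle the
difference of the phases is `α e(s) + R` with `|α| ≥ 1 / P`. -/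
theorem volume_phase_sub_lt_le {k m : Freq p} (h : k ≠ m) (ε : ℝ) :
    volume {θ | ‖phase p θ k - phase p θ m‖ < ε} ≤
      ENNReal.ofReal (Fintype.card (Freq p) * ε) := by
  have hmeas : MeasurableSet {θ | ‖phase p θ k - phase p θ m‖ < ε} :=
    measurableSet_lt ((continuous_phase p k).sub (continuous_phase p m)).norm.measurable
      measurable_const
  obtain ⟨j, hj⟩ := Function.ne_iff.1 h
  refine measure_le_of_forall_slice_le (ν := (volume : Measure UnitAddCircle))
    (φ := fun s => Pi.single j s) ?_ hmeas fun θ => ?_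
  · exact (continuous_single j).measurable
  have hP : (0 : ℝ) < Fintype.card (Freq p) := by exact_mod_cast Fintype.card_pos
  set α : ℂ := toCircle (θ j + k.point j) - toCircle (θ j + m.point j) with hα
  set R : ℂ := (phase p θ k - phase p θ m) - α with hR
  have hαnorm : (Fintype.card (Freq p) : ℝ)⁻¹ ≤ ‖α‖ := by
    have h1 := four_mul_norm_sub_le (θ j + k.point j) (θ j + m.point j)
    have h3 : θ j + k.point j - (θ j + m.point j) =
        ((k.coord j - m.coord j : ℝ) : UnitAddCircle) := by
      rw [add_sub_add_left_eq_sub, AddCircle.coe_sub]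
      rfl
    rw [h3] at h1
    have h2 := inv_card_le_norm_coord_sub p hj
    linarith [inv_pos.2 hP]
  have hα0 : 0 < ‖α‖ := (inv_pos.2 hP).trans_le hαnorm
  have hslice (s : UnitAddCircle) : phase p (Pi.single j s + θ) k - phase p (Pi.single j s + θ) m =
      α * (toCircle s - (-(R / α))) := by
    have hk (k : Freq p) : phase p (Pi.single j s + θ) k =
        phase p θ k + (toCircle s - 1) * toCircle (θ j + k.point j) := by
      rw [phase, phase, ← Finset.add_sum_erase _ _ (Finset.mem_univ j),
        ← Finset.add_sum_erase (Finset.univ : Finset (Fin d)) _ (Finset.mem_univ j)]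
      have hrest : ∑ i ∈ Finset.univ.erase j,
          (toCircle ((Pi.single j s + θ : Fin d → UnitAddCircle) i + k.point i) : ℂ) =
          ∑ i ∈ Finset.univ.erase j, (toCircle (θ i + k.point i) : ℂ) := by
        refine Finset.sum_congr rfl fun i hi => ?_
        rw [Pi.add_apply, Pi.single_eq_of_ne (Finset.ne_of_mem_erase hi), zero_add]
      rw [hrest, Pi.add_apply, Pi.single_eq_same, add_assoc s, toCircle_add, Circle.coe_mul]
      ring
    have : α ≠ 0 := norm_pos_iff.1 hα0
    rw [hk, hk]
    field_simp
    rw [hR, hα]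
    ring
  refine (measure_mono fun s hs => ?_).trans (volume_norm_toCircle_sub_lt_le (-(R / α)) _)
  have hs' : ‖phase p (Pi.single j s + θ) k - phase p (Pi.single j s + θ) m‖ < ε := hs
  change ‖(toCircle s : ℂ) - (-(R / α))‖ < _
  rw [hslice, norm_mul] at hs'
  set y := ‖(toCircle s : ℂ) - (-(R / α))‖
  have hy : 0 ≤ y := norm_nonneg _
  have := mul_le_mul_of_nonneg_right hαnorm hy
  rw [inv_mul_eq_div, div_le_iff₀ hP] at this
  nlinarith

theorem isHermitian_torus (θ : Fin d → UnitAddCircle) :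
    (diagonal (phase p θ + conjPhase p θ) +
      Matrix.of (fun k m => potentialCoeff p V (m - k))).IsHermitian := by
  choose x hx using fun j => QuotientAddGroup.mk_surjective (θ j)
  have hθ : θ = fun j => (x j : UnitAddCircle) := funext fun j => (hx j).symm
  rw [hθ, ← blochMatrix_eq]
  exact blochMatrix_isHermitian p V x

theorem card_freq : Fintype.card (Freq p) = ∏ j, p j := by
  rw [Fintype.card_pi]
  simp only [ZMod.card]

/-- Both `minorSumDet` with unit weights, which is the discriminant of the spectrum up to sign, and
`minorSumDet` with the weights `phaseDeriv`, which is the discriminant times the product of the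
derivatives of the eigenvalues up to sign, are bounded below off a set of small measure. -/
theorem exists_measurableSet_minorSumDet_ge (j : Fin d) {ε : ℝ} (hε : 0 < ε) (hε2 : ε ≤ 1 / 2) :
    ∃ G : Set (Fin d → UnitAddCircle), MeasurableSet G ∧
      volume Gᶜ ≤ ENNReal.ofReal (32 * Fintype.card (Freq p) ^ 3 * ε) ∧
      ∀ x : Fin d → ℝ, (fun j => (x j : UnitAddCircle)) ∈ G →
        ε ^ (5 * Fintype.card (Freq p) ^ 2) ≤ ‖minorSumDet (blochMatrix p V x) 1‖ ∧
        ε ^ (5 * Fintype.card (Freq p) ^ 2) ≤ ‖minorSumDet (blochMatrix p V x)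
          (phaseDeriv p j fun j => (x j : UnitAddCircle))‖ := by
  set P := Fintype.card (Freq p) with hP
  have hP1 : 1 ≤ P := Fintype.card_pos
  set W : Matrix (Freq p) (Freq p) ℂ := Matrix.of (fun k m => potentialCoeff p V (m - k)) with hW
  have hdeg : P * (2 + P * 2) ≤ 4 * P ^ 2 := by nlinarith
  obtain ⟨hm1, hv1⟩ := volume_separated_minorSumDet_lt_le (W := W) (b := fun _ _ => 1)
    (continuous_phase p) (continuous_conjPhase p) (fun _ => continuous_const)
    (isHermitian_torus p V) (toCircle_mul_phase p) (conjPhase_neg_add p)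
    (fun θ => ⟨fun _ => 1, fun _ => by simp, fun _ => by simp, fun s => ⟨1, by simp⟩⟩)
    hε hε2 hdeg
  obtain ⟨hm2, hv2⟩ := volume_separated_minorSumDet_lt_le (W := W) (b := phaseDeriv p j)
    (continuous_phase p) (continuous_conjPhase p) (continuous_phaseDeriv p j)
    (isHermitian_torus p V) (toCircle_mul_phase p) (conjPhase_neg_add p)
    (fun θ => ⟨fun k => C (2 * Real.pi * Complex.I) *
        (C (toCircle (θ j + k.point j) : ℂ) -
          X ^ 2 * C (toCircle (-(θ j + k.point j)) : ℂ)), fun k =>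
          (natDegree_C_mul_le _ _).trans (by compute_degree),
        fun k => by
          have h : eval 0 (C (2 * Real.pi * Complex.I) * (C (toCircle (θ j + k.point j) : ℂ) -
              X ^ 2 * C (toCircle (-(θ j + k.point j)) : ℂ))) =
              2 * Real.pi * Complex.I * toCircle (θ j + k.point j) := by
            simp only [eval_mul, eval_C, eval_sub, eval_pow, eval_X]
            ring
          rw [h, norm_mul, Circle.norm_coe]
          simp [abs_of_pos Real.pi_pos]
          linarith [Real.pi_gt_three],
        fun s => ⟨toCircle s, Circle.norm_coe _, fun k => by
          simp only [phaseDeriv, Pi.add_apply, toCircle_neg_neg_add, eval_mul, eval_C, eval_sub,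
            eval_pow, eval_X]
          have := toCircle_neg_add s (θ j + k.point j)
          rw [add_assoc, ← this]
          ring⟩⟩)
    hε hε2 hdeg
  rw [← hP] at hm1 hv1 hm2 hv2
  set B₁ := {θ | (∀ k m, k ≠ m → ε ≤ ‖phase p θ k - phase p θ m‖) ∧
    ‖minorSumDet (diagonal (phase p θ + conjPhase p θ) + W) (fun _ => 1)‖ <
      ε ^ (P ^ 2 + 4 * P ^ 2)} with hB₁
  set B₂ := {θ | (∀ k m, k ≠ m → ε ≤ ‖phase p θ k - phase p θ m‖) ∧
    ‖minorSumDet (diagonal (phase p θ + conjPhase p θ) + W) (phaseDeriv p j θ)‖ <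
      ε ^ (P ^ 2 + 4 * P ^ 2)} with hB₂
  set B₀ : Set (Fin d → UnitAddCircle) := ⋃ km ∈ (Finset.univ : Finset (Freq p × Freq p)).filter
    fun km => km.1 ≠ km.2, {θ | ‖phase p θ km.1 - phase p θ km.2‖ < ε} with hB₀
  have hm0 : MeasurableSet B₀ := Finset.measurableSet_biUnion _ fun km _ =>
    measurableSet_lt ((continuous_phase p km.1).sub (continuous_phase p km.2)).norm.measurable
      measurable_const
  have hv0 : volume B₀ ≤ ENNReal.ofReal (P ^ 2 * (P * ε)) := by
    refine (measure_biUnion_finset_le _ _).trans ((Finset.sum_le_sum fun km hkm =>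
      volume_phase_sub_lt_le p (Finset.mem_filter.1 hkm).2 ε).trans ?_)
    rw [Finset.sum_const, nsmul_eq_mul, ENNReal.ofReal_mul (p := (P : ℝ) ^ 2) (by positivity),
      ← Nat.cast_pow, ENNReal.ofReal_natCast]
    gcongr
    refine (Finset.card_filter_le _ _).trans ?_
    rw [Finset.card_univ, Fintype.card_prod, sq]
  refine ⟨(B₀ ∪ B₁ ∪ B₂)ᶜ, ((hm0.union hm1).union hm2).compl, ?_, fun x hx => ?_⟩
  · rw [compl_compl]
    refine (measure_union_le _ _).trans ((add_le_add_left (measure_union_le _ _) _).trans ?_)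
    refine (add_le_add (add_le_add hv0 hv1) hv2).trans ?_
    rw [← ENNReal.ofReal_add (by positivity) (by positivity),
      ← ENNReal.ofReal_add (by positivity) (by positivity)]
    refine ENNReal.ofReal_le_ofReal ?_
    push_cast
    have h1 : (1 : ℝ) ≤ P := by exact_mod_cast hP1
    have h2 : (P : ℝ) ^ 2 ≤ P ^ 3 := pow_le_pow_right₀ h1 (by norm_num)
    nlinarith
  · simp only [Set.mem_compl_iff, Set.mem_union, not_or] at hx
    obtain ⟨⟨h0, h1⟩, h2⟩ := hx
    have hsep : ∀ k m, k ≠ m → ε ≤ ‖phase p (fun j => (x j : UnitAddCircle)) k -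
        phase p (fun j => (x j : UnitAddCircle)) m‖ := by
      intro k m hkm
      by_contra! hlt
      exact h0 (Set.mem_biUnion (x := (k, m)) (by simpa using hkm) hlt)
    have he : 5 * P ^ 2 = P ^ 2 + 4 * P ^ 2 := by ring
    rw [blochMatrix_eq, he]
    exact ⟨not_lt.1 fun hlt => h1 ⟨hsep, hlt⟩, not_lt.1 fun hlt => h2 ⟨hsep, hlt⟩⟩

end Bloch
end PeriodicSchrodinger

namespace PeriodicSchrodinger
open Polynomial Matrix MeasureTheory AddCircle
open scoped ENNReal

/-! ### Bounds for the Bloch matrix and its eigenvalues -/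

section Bounds
variable {d : ℕ} {p : Fin d → ℕ} {V : (Fin d → ℤ) → ℝ}

theorem IsPeriodic.update_add_mul (hV : IsPeriodic p V) (j : Fin d) (n : Fin d → ℤ) (z : ℤ) :
    V (Function.update n j (n j + p j * z)) = V n := by
  have hnat (n : Fin d → ℤ) (k : ℕ) : V (Function.update n j (n j + p j * k)) = V n := by
    induction k with
    | zero => simp
    | succ k ih =>
      rw [← ih, ← hV j (Function.update n j (n j + p j * k))]
      simp only [Function.update_idem, Function.update_self]
      congr 2
      push_cast
      ring
  obtain ⟨k, rfl | rfl⟩ := z.eq_nat_or_neg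
  · exact hnat n k
  · rw [← hnat (Function.update n j (n j + p j * -(k : ℤ))) k]
    simp

theorem IsPeriodic.apply_emod (hV : IsPeriodic p V) (n : Fin d → ℤ) :
    V (fun j => n j % p j) = V n := by
  have h (s : Finset (Fin d)) : V (fun j => if j ∈ s then n j % p j else n j) = V n := by
    induction s using Finset.induction_on with
    | empty => simp
    | insert a s ha ih =>
      rw [← ih, ← hV.update_add_mul a (fun j => if j ∈ s then n j % p j else n j)
        (-(n a / p a))]
      congr 1
      ext j
      by_cases hj : j = a
      · subst hj
        simp only [Finset.mem_insert_self, if_true, Function.update_self, ha, if_false]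
        rw [Int.emod_def]
        ring
      · simp [hj]
  simpa using h Finset.univ

theorem IsPeriodic.abs_le_supNorm [∀ j, NeZero (p j)] (hV : IsPeriodic p V) (n : Fin d → ℤ) :
    |V n| ≤ supNorm V := by
  refine le_ciSup (f := fun n => |V n|) (Set.Finite.bddAbove ?_) n
  refine (Set.finite_range fun m : (∀ j, Fin (p j)) => |V fun j => ((m j : ℕ) : ℤ)|).subset ?_
  rintro _ ⟨n, rfl⟩
  have hpos (j : Fin d) : (0 : ℤ) < p j := by exact_mod_cast NeZero.pos (p j)
  refine ⟨fun j => ⟨(n j % p j).toNat, ?_⟩, ?_⟩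
  · have := Int.emod_lt_of_pos (n j) (hpos j)
    have := Int.emod_nonneg (n j) (hpos j).ne'
    omega
  · change |V fun j => (((n j % p j).toNat : ℕ) : ℤ)| = |V n|
    rw [← hV.apply_emod n]
    congr 3
    ext j
    exact Int.toNat_of_nonneg (Int.emod_nonneg (n j) (hpos j).ne')

theorem norm_potentialCoeff_le [∀ j, NeZero (p j)] {v : ℝ} (hv : ∀ n, |V n| ≤ v) (k : Freq p) :
    ‖potentialCoeff p V k‖ ≤ v := by
  have hpos : (0 : ℝ) < ∏ j, (p j : ℝ) :=
    Finset.prod_pos fun j _ => by exact_mod_cast NeZero.pos (p j)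
  have hnorm : ‖(∏ j, (p j : ℂ))⁻¹‖ = (∏ j, (p j : ℝ))⁻¹ := by
    rw [norm_inv, norm_prod]
    simp
  rw [potentialCoeff, norm_mul, hnorm, inv_mul_le_iff₀ hpos]
  refine (norm_sum_le _ _).trans ((Finset.sum_le_card_nsmul _ _ v fun n _ => ?_).trans ?_)
  · have h : -(2 * Real.pi * Complex.I * ∑ j, (k.coord j : ℂ) * ((n j : ℕ) : ℂ)) =
        ((-(2 * Real.pi * ∑ j, k.coord j * (n j : ℕ)) : ℝ) : ℂ) * Complex.I := by
      push_cast
      ring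
    rw [norm_mul, h, Complex.norm_exp_ofReal_mul_I, mul_one, Complex.norm_real]
    exact hv _
  · rw [nsmul_eq_mul, Finset.card_univ, Fintype.card_pi]
    simp

theorem abs_sum_two_mul_cos_le (x : Fin d → ℝ) (k : Freq p) :
    |∑ j, 2 * Real.cos (2 * Real.pi * (x j + k.coord j))| ≤ 2 * d := by
  refine (Finset.abs_sum_le_sum_abs _ _).trans
    ((Finset.sum_le_card_nsmul _ _ 2 fun j _ => ?_).trans ?_)
  · rw [abs_mul, abs_two]
    linarith [Real.abs_cos_le_one (2 * Real.pi * (x j + k.coord j))]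
  · simp [mul_comm]

theorem norm_phaseDeriv_le (j : Fin d) (θ : Fin d → UnitAddCircle) (k : Freq p) :
    ‖phaseDeriv p j θ k‖ ≤ 16 := by
  rw [phaseDeriv, norm_mul]
  have h := norm_sub_le (toCircle (θ j + k.point j) : ℂ) (toCircle (-(θ j + k.point j)))
  rw [Circle.norm_coe, Circle.norm_coe] at h
  have h2 : ‖(2 * Real.pi * Complex.I : ℂ)‖ = 2 * Real.pi := by
    simp [abs_of_pos Real.pi_pos]
  rw [h2]
  nlinarith [Real.pi_lt_four, Real.pi_pos, norm_nonneg
    ((toCircle (θ j + k.point j) : ℂ) - toCircle (-(θ j + k.point j)))]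

variable [∀ j, NeZero (p j)]

theorem sum_norm_blochMatrix_le {v : ℝ} (hv : ∀ n, |V n| ≤ v) (x : Fin d → ℝ) (k : Freq p) :
    ∑ m, ‖blochMatrix p V x k m‖ ≤ 2 * d + Fintype.card (Freq p) * v := by
  have h1 (m : Freq p) : ‖blochMatrix p V x k m‖ ≤ (if k = m then (2 * d : ℝ) else 0) + v := by
    rw [blochMatrix, Matrix.add_apply]
    refine (norm_add_le _ _).trans (add_le_add ?_ (norm_potentialCoeff_le hv _))
    rw [diagonal_apply]
    split_ifs
    · rw [Complex.norm_real]
      exact abs_sum_two_mul_cos_le x k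
    · simp
  refine (Finset.sum_le_sum fun m _ => h1 m).trans (le_of_eq ?_)
  rw [Finset.sum_add_distrib]
  simp

theorem abs_blochEigenvalue_le {v : ℝ} (hv : ∀ n, |V n| ≤ v) (x : Fin d → ℝ)
    (l : Fin (Fintype.card (Freq p))) :
    |blochEigenvalue p V x l| ≤ 2 * d + Fintype.card (Freq p) * v :=
  abs_eigenvalues₀_le _ (sum_norm_blochMatrix_le hv x) l

theorem norm_scalar_sub_blochMatrix_apply_le {v : ℝ} (hv : ∀ n, |V n| ≤ v) (x : Fin d → ℝ)
    (l : Fin (Fintype.card (Freq p))) (i j : Freq p) :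
    ‖(scalar (Freq p) (blochEigenvalue p V x l : ℂ) - blochMatrix p V x) i j‖ ≤
      2 * (2 * d + Fintype.card (Freq p) * v) := by
  have h1 := abs_blochEigenvalue_le hv x l
  have h2 := (Finset.single_le_sum (fun m _ => norm_nonneg (blochMatrix p V x i m))
    (Finset.mem_univ j)).trans (sum_norm_blochMatrix_le hv x i)
  rw [Matrix.sub_apply, two_mul]
  refine (norm_sub_le _ _).trans (add_le_add ?_ h2)
  rw [scalar_apply, diagonal_apply]
  split_ifs
  · rwa [Complex.norm_real]
  · rw [norm_zero]
    exact (abs_nonneg _).trans h1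

/-- At a simple spectrum the eigenvalues are differentiable in `x j`. Implicit differentiation of
`det (E - Ĥ_x)` gives the derivative as a weighted sum of minors divided by `∏ m ≠ l, (E_l - E_m)`.
-/
theorem exists_hasDerivAt_blochEigenvalue (j : Fin d) (x : Fin d → ℝ)
    (hx : StrictMono (blochEigenvalue p V x)) (l : Fin (Fintype.card (Freq p))) :
    ∃ D, HasDerivAt (fun t => blochEigenvalue p V (Function.update x j t) l) D (x j) ∧
      ‖∑ k, phaseDeriv p j (fun j => (x j : UnitAddCircle)) k *
        (scalar (Freq p) (blochEigenvalue p V x l : ℂ) - blochMatrix p V x).adjugate k k‖ =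
      |D| * ∏ m ∈ Finset.univ.erase l, |blochEigenvalue p V x l - blochEigenvalue p V x m| := by
  have hmono (t : ℝ) : Monotone (blochEigenvalue p V (Function.update x j t)) := fun a b hab =>
    (blochMatrix_isHermitian p V (Function.update x j t)).eigenvalues₀_antitone
      (Fin.rev_le_rev.2 hab)
  set W : Matrix (Freq p) (Freq p) ℂ := Matrix.of (fun k m => potentialCoeff p V (m - k)) with hW
  have hdiag (k : Freq p) : HasDerivAt (fun t : ℝ => -((∑ i, 2 * Real.cos (2 * Real.pi *
      ((Function.update x j t) i + k.coord i)) : ℝ) : ℂ))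
      (-phaseDeriv p j (fun j => (x j : UnitAddCircle)) k) (x j) := by
    rw [phaseDeriv_coe]
    refine HasDerivAt.neg (HasDerivAt.ofReal_comp ?_)
    have hsum : (fun t : ℝ => ∑ i, 2 * Real.cos (2 * Real.pi *
        ((Function.update x j t) i + k.coord i))) = fun t =>
        2 * Real.cos (2 * Real.pi * (t + k.coord j)) + ∑ i ∈ Finset.univ.erase j,
          2 * Real.cos (2 * Real.pi * (x i + k.coord i)) := by
      ext t
      rw [← Finset.add_sum_erase _ _ (Finset.mem_univ j), Function.update_self]
      congr 1
      refine Finset.sum_congr rfl fun i hi => ?_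
      rw [Function.update_of_ne (Finset.ne_of_mem_erase hi)]
    rw [hsum]
    refine HasDerivAt.add_const _ ?_
    have := (((((hasDerivAt_id (x j)).add_const (k.coord j)).const_mul (2 * Real.pi)).cos).const_mul
      (2 : ℝ))
    refine this.congr_deriv ?_
    simp only [id]
    ring
  have hdet (l) : HasDerivAt (fun t : ℝ => ∏ m : Fin (Fintype.card (Freq p)),
      ((blochEigenvalue p V x l : ℂ) - blochEigenvalue p V (Function.update x j t) m))
      (∑ k, -phaseDeriv p j (fun j => (x j : UnitAddCircle)) k *
        (scalar (Freq p) (blochEigenvalue p V x l : ℂ) - blochMatrix p V x).adjugate k k)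
      (x j) := by
    have h := hasDerivAt_det_add_diagonal
      (scalar (Freq p) (blochEigenvalue p V x l : ℂ) - W) hdiag
    have hmat (t : ℝ) : scalar (Freq p) (blochEigenvalue p V x l : ℂ) - W +
        diagonal (fun k => -((∑ i, 2 * Real.cos (2 * Real.pi *
          ((Function.update x j t) i + k.coord i)) : ℝ) : ℂ)) =
        scalar (Freq p) (blochEigenvalue p V x l : ℂ) -
          blochMatrix p V (Function.update x j t) := by
      rw [blochMatrix, ← diagonal_neg]
      abel
    rw [hmat (x j), Function.update_eq_self] at h
    simp only [hmat] at h
    have heq : (fun t : ℝ => ∏ m : Fin (Fintype.card (Freq p)),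
        ((blochEigenvalue p V x l : ℂ) - blochEigenvalue p V (Function.update x j t) m)) =
        fun t => (scalar (Freq p) (blochEigenvalue p V x l : ℂ) -
          blochMatrix p V (Function.update x j t)).det := by
      funext t
      rw [det_scalar_sub_eq_prod (blochMatrix_isHermitian p V _)]
      rfl
    rw [heq]
    exact h
  have hup : blochEigenvalue p V (Function.update x j (x j)) = blochEigenvalue p V x := by
    rw [Function.update_eq_self]
  obtain ⟨D, hD, hDn⟩ := exists_hasDerivAt_of_hasDerivAt_prod
    (E := fun t => blochEigenvalue p V (Function.update x j t)) hmono (t₀ := x j)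
    (by rwa [hup]) (by simpa only [hup] using hdet) l
  refine ⟨D, hD, ?_⟩
  rw [hup] at hDn
  rw [← hDn, ← norm_neg, ← Finset.sum_neg_distrib]
  simp only [neg_mul]

end Bounds

/-! ### Collecting the constants -/

section Constants

theorem le_mul_pow_of_le_prod {ι : Type*} [Fintype ι] {f : ι → ℝ} {T B : ℝ} (hB : 1 ≤ B)
    (h0 : ∀ i, 0 ≤ f i) (hf : ∀ i, f i ≤ B) (s : Finset ι) (hT : T ≤ ∏ i ∈ s, f i) {i : ι}
    (hi : i ∈ s) : T ≤ f i * B ^ Fintype.card ι := by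
  classical
  refine hT.trans ?_
  rw [← Finset.mul_prod_erase _ _ hi]
  refine mul_le_mul_of_nonneg_left ?_ (h0 i)
  calc ∏ x ∈ s.erase i, f x ≤ ∏ _x ∈ s.erase i, B :=
        Finset.prod_le_prod (fun i _ => h0 i) fun i _ => hf i
    _ = B ^ (s.erase i).card := by simp
    _ ≤ _ := pow_le_pow_right₀ hB (Finset.card_le_univ _)

/-- After taking logarithms and dividing by `P ^ 2`, this bounds `O(1) + 21 log P + 5 log (1 / η)`
by `C log P log (1 / η)`, where both factors `log P` and `log (1 / η)` are at least `log 2`. -/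
theorem exists_exponent (c : ℝ) (hc : 1 ≤ c) : ∃ C : ℝ, 1 < C ∧ ∀ P : ℕ, 2 ≤ P → ∀ η : ℝ, 0 < η →
    η < 1 / 2 → η ^ (C * (P : ℝ) ^ 2 * Real.log P) * (c * (P : ℝ) ^ 3) ^ (2 * P ^ 2) ≤
      (η / (64 * (P : ℝ) ^ 3)) ^ (5 * P ^ 2) := by
  have hlog2 : 0 < Real.log 2 := Real.log_pos one_lt_two
  set a := 2 * Real.log c + 5 * Real.log 64 with ha
  have ha0 : 0 ≤ a := add_nonneg (mul_nonneg zero_le_two (Real.log_nonneg hc))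
    (mul_nonneg (by norm_num) (Real.log_nonneg (by norm_num)))
  refine ⟨1 + 26 / Real.log 2 + a / Real.log 2 ^ 2, ?_, fun P hP η hη hη2 => ?_⟩
  · have : 0 < 26 / Real.log 2 := by positivity
    have : 0 ≤ a / Real.log 2 ^ 2 := by positivity
    linarith
  have hP0 : (0 : ℝ) < P := by positivity
  have hlogP : Real.log 2 ≤ Real.log P := Real.log_le_log two_pos (by exact_mod_cast hP)
  have hL : Real.log 2 ≤ -Real.log η := by
    rw [← Real.log_inv]
    refine Real.log_le_log two_pos ?_
    rw [le_inv_comm₀ two_pos hη]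
    linarith
  have hc0 : 0 < c := by linarith
  rw [← Real.log_le_log_iff (by positivity) (by positivity), Real.log_mul (by positivity)
    (by positivity), Real.log_rpow hη, Real.log_pow, Real.log_pow, Real.log_mul hc0.ne'
    (by positivity), Real.log_div hη.ne' (by positivity), Real.log_mul (by norm_num)
    (by positivity), Real.log_pow]
  push_cast
  set p := Real.log P
  set L := -Real.log η with hLdef
  rw [show Real.log η = -L by rw [hLdef, neg_neg]]
  have hkey : a + 21 * p + 5 * L ≤
      (1 + 26 / Real.log 2 + a / Real.log 2 ^ 2) * p * L := by
    set u := Real.log 2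
    have h1 : a ≤ a / u ^ 2 * p * L := by
      rw [mul_assoc, div_mul_eq_mul_div, le_div_iff₀ (by positivity), sq]
      exact mul_le_mul_of_nonneg_left (mul_le_mul hlogP hL hlog2.le (hlog2.le.trans hlogP)) ha0
    have h2 : p ≤ 1 / u * p * L := by
      rw [mul_assoc, div_mul_eq_mul_div, le_div_iff₀ hlog2, one_mul]
      exact mul_le_mul_of_nonneg_left hL (hlog2.le.trans hlogP)
    have h3 : L ≤ 1 / u * p * L := by
      rw [mul_assoc, div_mul_eq_mul_div, le_div_iff₀ hlog2, one_mul, mul_comm]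
      exact mul_le_mul_of_nonneg_right hlogP (hlog2.le.trans hL)
    have h4 : 0 ≤ p * L := mul_nonneg (hlog2.le.trans hlogP) (hlog2.le.trans hL)
    have h5 : (1 + 26 / u + a / u ^ 2) * p * L =
        p * L + 26 * (1 / u * p * L) + a / u ^ 2 * p * L := by ring
    linarith
  have := mul_le_mul_of_nonneg_left hkey (sq_nonneg (P : ℝ))
  rw [ha] at this
  linarith

end Constants
end PeriodicSchrodinger

theorem theorem4 (d : ℕ) (hd : 1 ≤ d) (v : ℝ) :
    ∃ C : ℝ, 1 < C ∧
      ∀ (p : Fin d → ℕ) [∀ j, NeZero (p j)], 2 ≤ ∏ j, p j →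
      ∀ V : (Fin d → ℤ) → ℝ, PeriodicSchrodinger.IsPeriodic p V →
        PeriodicSchrodinger.supNorm V = v →
      ∀ η : ℝ, 0 < η → η < 1 / 2 →
      ∃ G : Set (Fin d → UnitAddCircle), MeasurableSet G ∧
        MeasureTheory.volume Gᶜ ≤ ENNReal.ofReal η ∧
        ∀ x : Fin d → ℝ, (fun j => (x j : UnitAddCircle)) ∈ G →
          PeriodicSchrodinger.IsDeltaSimple p V x
            (η ^ (C * ((∏ j, p j : ℕ) : ℝ) ^ 2 * Real.log ((∏ j, p j : ℕ) : ℝ))) ∧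
          ∀ l : Fin (Fintype.card (PeriodicSchrodinger.Freq p)), ∃ D : ℝ,
            HasDerivAt
              (fun t : ℝ => PeriodicSchrodinger.blochEigenvalue p V
                (Function.update x (⟨d - 1, by omega⟩ : Fin d) t) l)
              D (x ⟨d - 1, by omega⟩) ∧
            η ^ (C * ((∏ j, p j : ℕ) : ℝ) ^ 2 * Real.log ((∏ j, p j : ℕ) : ℝ)) ≤ |D| := by
  obtain ⟨C, hC1, hC⟩ := PeriodicSchrodinger.exists_exponent (16 * (4 * d + 2 * |v| + 1))
    (by have := abs_nonneg v; have : (0 : ℝ) ≤ d := Nat.cast_nonneg d; linarith)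
  refine ⟨C, hC1, fun p _ hp V hV hVv η hη hη2 => ?_⟩
  have hvbound (n) : |V n| ≤ |v| := by
    rw [← hVv]
    exact (hV.abs_le_supNorm n).trans (le_abs_self _)
  rw [← PeriodicSchrodinger.card_freq p] at hp ⊢
  set P := Fintype.card (PeriodicSchrodinger.Freq p) with hPdef
  set j : Fin d := ⟨d - 1, by omega⟩ with hj
  set τ := η ^ (C * (P : ℝ) ^ 2 * Real.log P) with hτ
  have hP2 : (2 : ℝ) ≤ P := by exact_mod_cast hp
  have hP0 : (0 : ℝ) < P := by linarith
  have hP3 : (1 : ℝ) ≤ (P : ℝ) ^ 3 := one_le_pow₀ (by linarith)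
  set ε := η / (64 * (P : ℝ) ^ 3) with hε
  have hε0 : 0 < ε := by positivity
  obtain ⟨G, hGm, hGv, hG⟩ := PeriodicSchrodinger.exists_measurableSet_minorSumDet_ge p V j hε0
    (by rw [hε, div_le_iff₀ (by positivity)]; linarith)
  refine ⟨G, hGm, hGv.trans (ENNReal.ofReal_le_ofReal ?_), fun x hx => ?_⟩
  · rw [hε, ← mul_div_assoc, div_le_iff₀ (by positivity)]
    nlinarith
  obtain ⟨hD, hR⟩ := hG x hx
  -- `K` bounds the spectral gaps and the entries of `E_l - Ĥ_x`, and `S ^ P` the products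
  -- `∏ m ≠ l, |E_l - E_m|` and the weighted sums of minors.
  set K : ℝ := (4 * d + 2 * |v| + 1) * P with hK
  set S : ℝ := 16 * (4 * d + 2 * |v| + 1) * (P : ℝ) ^ 3 with hS
  have hd0 : (0 : ℝ) ≤ d := Nat.cast_nonneg d
  have hv0 := abs_nonneg v
  have hKle : 2 * (2 * d + P * |v|) ≤ K := by
    rw [hK]
    nlinarith
  have hK1 : 1 ≤ K := by
    rw [hK]
    nlinarith [mul_nonneg hd0 hP0.le, mul_nonneg hv0 hP0.le]
  have hSK : S = 16 * P * (P * K) := by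
    rw [hS, hK]
    ring
  have hKS : K ≤ S := by
    have h : 1 ≤ 16 * (P : ℝ) * P := by nlinarith
    rw [hSK, ← mul_assoc]
    exact le_mul_of_one_le_left (zero_le_one.trans hK1) h
  have hS1 : 1 ≤ S := hK1.trans hKS
  have hτS : τ * S ^ (2 * P ^ 2) ≤ ε ^ (5 * P ^ 2) := hC P hp η hη hη2
  set T := ε ^ (5 * P ^ 2) with hT
  have hT0 : 0 < T := by positivity
  set E := PeriodicSchrodinger.blochEigenvalue p V x with hE
  have hgap (l m : Fin P) : |E l - E m| ≤ K := by
    have h1 := PeriodicSchrodinger.abs_blochEigenvalue_le hvbound x l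
    have h2 := PeriodicSchrodinger.abs_blochEigenvalue_le hvbound x m
    have h3 := abs_sub (E l) (E m)
    linarith
  set f : Fin P → ℝ := fun l => ∏ m ∈ Finset.univ.erase l, |E l - E m| with hf
  have hf0 (l : Fin P) : 0 ≤ f l := Finset.prod_nonneg fun _ _ => abs_nonneg _
  have hfS (l : Fin P) : f l ≤ S ^ P := by
    calc f l ≤ ∏ _m ∈ Finset.univ.erase l, S :=
          Finset.prod_le_prod (fun _ _ => abs_nonneg _) fun m _ => (hgap l m).trans hKS
      _ = S ^ (Finset.univ.erase l).card := by simp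
      _ ≤ S ^ P := pow_le_pow_right₀ hS1 ((Finset.card_le_univ _).trans (by simp))
  have hSP : 1 ≤ S ^ P := one_le_pow₀ hS1
  have hSPP : S ^ P ≤ (S ^ P) ^ P := le_self_pow₀ hSP (by omega)
  have hSpow : (S ^ P) ^ P * (S ^ P) ^ P = S ^ (2 * P ^ 2) := by
    rw [← pow_mul, ← pow_add]
    congr 1
    ring
  have hherm := PeriodicSchrodinger.blochMatrix_isHermitian p V x
  have hDprod : T ≤ ∏ l, f l := by
    refine hD.trans (le_of_eq ?_)
    have h := PeriodicSchrodinger.norm_minorSumDet_smul_eq_prod hherm 1 norm_one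
    rw [one_smul] at h
    rw [h]
    refine Finset.prod_congr rfl fun l _ => ?_
    simp only [Pi.one_apply, one_mul]
    rw [PeriodicSchrodinger.sum_adjugate_scalar_sub_eigenvalue hherm, norm_prod]
    refine Finset.prod_congr rfl fun m _ => ?_
    rw [← Complex.ofReal_sub, Complex.norm_real]
    rfl
  have hTf (l : Fin P) : T ≤ f l * (S ^ P) ^ P := by
    simpa using PeriodicSchrodinger.le_mul_pow_of_le_prod hSP hf0 hfS Finset.univ hDprod
      (Finset.mem_univ l)
  -- All factors but one are bounded above, so the lower bound of the product
  -- passes to that factor.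
  have hTgap (l m : Fin P) (hlm : m ≠ l) : T ≤ |E l - E m| * S ^ (2 * P ^ 2) := by
    have h1 := PeriodicSchrodinger.le_mul_pow_of_le_prod hS1 (fun m => abs_nonneg (E l - E m))
      (fun m => (hgap l m).trans hKS) (Finset.univ.erase l) le_rfl
      (Finset.mem_erase.2 ⟨hlm, Finset.mem_univ m⟩)
    rw [Fintype.card_fin] at h1
    calc T ≤ f l * (S ^ P) ^ P := hTf l
      _ ≤ (|E l - E m| * S ^ P) * (S ^ P) ^ P := by gcongr
      _ ≤ (|E l - E m| * (S ^ P) ^ P) * (S ^ P) ^ P := by gcongr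
      _ = _ := by rw [mul_assoc, hSpow]
  have hmono : Monotone E := fun a b hab => hherm.eigenvalues₀_antitone (Fin.rev_le_rev.2 hab)
  have hinj : Function.Injective E := fun l m hlm => by
    by_contra hne
    have := hTgap l m (Ne.symm hne)
    rw [hlm, sub_self, abs_zero, zero_mul] at this
    linarith
  have hstrict : StrictMono E := hmono.strictMono_of_injective hinj
  have hSpos : 0 < S ^ (2 * P ^ 2) := by positivity
  refine ⟨fun l l' hll' => ?_, fun l => ?_⟩
  · have hlt : l < l' := by
      rw [Fin.lt_def]
      omega
    have h := hτS.trans (hTgap l' l hlt.ne)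
    rw [abs_of_pos (sub_pos.2 (hstrict hlt))] at h
    exact le_of_mul_le_mul_right h hSpos
  · obtain ⟨D, hDeriv, hDn⟩ :=
      PeriodicSchrodinger.exists_hasDerivAt_blochEigenvalue j x hstrict l
    refine ⟨D, hDeriv, ?_⟩
    set g : Fin P → ℝ := fun l => ‖∑ k, PeriodicSchrodinger.phaseDeriv p j
      (fun j => (x j : UnitAddCircle)) k * (Matrix.scalar (PeriodicSchrodinger.Freq p) (E l : ℂ) -
        PeriodicSchrodinger.blochMatrix p V x).adjugate k k‖ with hg
    have hgS (l : Fin P) : g l ≤ S ^ P := by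
      have hadj (k) : ‖PeriodicSchrodinger.phaseDeriv p j (fun j => (x j : UnitAddCircle)) k *
          (Matrix.scalar (PeriodicSchrodinger.Freq p) (E l : ℂ) -
            PeriodicSchrodinger.blochMatrix p V x).adjugate k k‖ ≤ 16 * (P * K) ^ P := by
        rw [norm_mul]
        exact mul_le_mul (PeriodicSchrodinger.norm_phaseDeriv_le _ _ _)
          (PeriodicSchrodinger.norm_adjugate_apply_self_le hK1 (fun i j =>
            (PeriodicSchrodinger.norm_scalar_sub_blochMatrix_apply_le hvbound x l i j).trans hKle)
            k) (norm_nonneg _) (by norm_num)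
      refine (norm_sum_le _ _).trans ((Finset.sum_le_card_nsmul _ _ _ fun k _ => hadj k).trans ?_)
      rw [nsmul_eq_mul, Finset.card_univ, ← hPdef, hSK, mul_pow (16 * (P : ℝ)), ← mul_assoc,
        mul_comm (P : ℝ) 16]
      have : 16 * (P : ℝ) ≤ (16 * P) ^ P := le_self_pow₀ (by linarith) (by omega)
      gcongr
    have hRprod : T ≤ ∏ l, g l := by
      refine hR.trans (le_of_eq ?_)
      have h := PeriodicSchrodinger.norm_minorSumDet_smul_eq_prod hherm
        (PeriodicSchrodinger.phaseDeriv p j fun j => (x j : UnitAddCircle)) norm_one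
      rw [one_smul] at h
      rw [h]
      rfl
    have hTg : T ≤ g l * (S ^ P) ^ P := by
      have h := PeriodicSchrodinger.le_mul_pow_of_le_prod hSP (fun _ => norm_nonneg _) hgS
        Finset.univ hRprod (Finset.mem_univ l)
      rwa [Fintype.card_fin] at h
    have hgl : g l = |D| * f l := hDn
    have hfin : τ * S ^ (2 * P ^ 2) ≤ |D| * S ^ (2 * P ^ 2) := by
      calc τ * S ^ (2 * P ^ 2) ≤ g l * (S ^ P) ^ P := hτS.trans hTg
        _ ≤ (|D| * (S ^ P) ^ P) * (S ^ P) ^ P := by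
          rw [hgl]
          gcongr
          exact (hfS l).trans hSPP
        _ = _ := by rw [mul_assoc, hSpow]
    exact le_of_mul_le_mul_right hfin hSpos
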